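/- **Setting.** Let $G$ be a locally compact Hausdorff étale groupoid with unit space $G^{0}$, and let $E$ be a twist over $G$: $E$ is a locally compact Hausdorff groupoid with a central extension $G^{0}\times\mathbb T\xrightarrow{\iota}E\xrightarrow{\pi}G$, where $\iota,\pi$ are continuous groupoid homomorphisms, $\iota$ is a homeomorphism onto its range, $\pi$ is an open surjection whose kernel $\pi^{-1}(G^0)$ is $\iota(G^{0}\times\mathbb T)$ and which restricts to a homeomorphism $E^{0}\to G^{0}$, $\iota(\pi(r(e)),1)=r(e)$, and, identifying $E^0$ with $G^0$, $\iota(r(e),z)e=e\,\iota(s(e),z)=:z\cdot e$ for $e\in E$, $z\in\mathbb T$. Let $C_0(G;E)$ be the set of $f\in C_0(E)$ with $f(z\cdot e)=zf(e)$ for all $z\in\mathbb T$, $e\in E$, and $C_c(G;E)=C_0(G;E)\cap C_c(E)$. The latter is a $*$-algebra under $$(f_1*f_2)(e)=\sum_{g\in G^{r(e)}}f_1(\sigma(g))\,f_2(\sigma(g)^{-1}e),\qquad f^*(e)=\overline{f(e^{-1})},$$ where $G^{u}=r^{-1}(u)$ and $\sigma:G\to E$ is any set-theoretic section of $\pi$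 (the choice is irrelevant). For $u\in G^{0}$ let $G_u=s^{-1}(u)$, $E_u=\pi^{-1}(G_u)$, let $\ell^2(G_u;E_u)$ be the Hilbert space of functions $\xi:E_u\to\mathbb C$ with $\xi(z\cdot e)=z\xi(e)$ and $\sum_{g\in G_u}|\xi(\sigma(g))|^2<\infty$, and let $\theta_u(f)\xi=f*\xi$. The reduced C*-algebra $C^*_r(G;E)$ is the completion of $C_c(G;E)$ in the norm $\|f\|_r=\sup_{u\in G^{0}}\|\theta_u(f)\|$, and $j_G:C^*_r(G;E)\to C_0(G;E)$ is the continuous linear extension of the inclusion $C_c(G;E)\subseteq C_0(G;E)$. For an open subgroupoid $S$ of $G$ with unit space $S^0$, $E_S=\pi^{-1}(S)$ is, by restricting $\iota$ and $\pi$, a twist over $S$; let $i:C^*_r(S;E_S)\to C^*_r(G;E)$ be the $*$-homomorphism that continuously extends extension by zero $C_c(S;E_S)\to C_c(G;E)$. A conditional expectation of a C*-algebra $A$ onto a C*-subalgebra $B$ is a contractive completely positive linear map $P:A\to A$ with $P(A)\subseteq B$, $P(b)=b$, $P(ba)=bP(a)$ and $P(ab)=P(a)b$ for $a\in A$, $b\in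 B$. It is faithful if $P(a^*a)=0$ implies $a=0$. **Proposition.** Suppose that the subgroupoid $S$ of $G$ is open and closed in $G$. Then there is a linear map $\Phi:C^*_r(G;E)\to C^*_r(S;E_S)$ such that 1. $\Phi(f)=f|_{E_S}$ for every $f\in C_c(G;E)$, and $\|\Phi(a)\|\le\|a\|$ for all $a\in C^*_r(G;E)$; 2. $i\circ\Phi$ is a conditional expectation of $C^*_r(G;E)$ onto $i(C^*_r(S;E_S))$; 3. $j_S(\Phi(a))=j_G(a)|_{E_S}$ for all $a\in C^*_r(G;E)$; 4. if $S^{0}=G^{0}$, then $\Phi(a^*a)=0$ implies $a=0$ for $a\in C^*_r(G;E)$; in particular $i\circ\Phi$ is faithful. -/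

import Mathlib

open Topology Set
open scoped ENNReal ZeroAtInfty

noncomputable section

namespace TwistedGroupoid

/-! ### Groupoids -/

/-- A groupoid, given by its set of arrows `G`. Units are identified with the identity arrows, so
range and source are maps `G → G`. The product `g * h` is only meaningful when `s g = r h`; the
value of the (total) function `*` on other pairs is irrelevant and never used. -/
class ArrowGroupoid (G : Type*) extends Mul G, Inv G where
  /-- range -/
  r : G → G
  /-- source -/
  s : G → G
  r_r : ∀ g, r (r g) = r g
  s_r : ∀ g, s (r g) = r g
  r_s : ∀ g, r (s g) = s g
  s_s : ∀ g, s (s g) = s g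
  r_mul : ∀ g h, s g = r h → r (g * h) = r g
  s_mul : ∀ g h, s g = r h → s (g * h) = s h
  comp_assoc : ∀ g h k, s g = r h → s h = r k → g * h * k = g * (h * k)
  r_mul_self : ∀ g, r g * g = g
  mul_s_self : ∀ g, g * s g = g
  r_inv : ∀ g, r g⁻¹ = s g
  s_inv : ∀ g, s g⁻¹ = r g
  mul_inv_eq : ∀ g, g * g⁻¹ = r g
  inv_mul_eq : ∀ g, g⁻¹ * g = s g

open ArrowGroupoid

attribute [simp] r_r s_r r_s s_s r_mul_self mul_s_self r_inv s_inv mul_inv_eq inv_mul_eq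

section Alg

variable {G : Type*} [ArrowGroupoid G]

theorem inv_mul_cancel_left' {g h : G} (hc : r g = r h) : g * (g⁻¹ * h) = h := by
  rw [← comp_assoc _ _ _ (by simp) (by simpa using hc), mul_inv_eq, hc, r_mul_self]

theorem mul_inv_cancel_left' {g h : G} (hc : s g = r h) : g⁻¹ * (g * h) = h := by
  rw [← comp_assoc _ _ _ (by simp) hc, inv_mul_eq, hc, r_mul_self]

theorem inv_mul_cancel_right' {g h : G} (hc : s g = s h) : g * h⁻¹ * h = g := by
  rw [comp_assoc _ _ _ (by simpa using hc) (by simp), inv_mul_eq, ← hc, mul_s_self]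

theorem mul_inv_cancel_right' {g h : G} (hc : s g = r h) : g * h * h⁻¹ = g := by
  rw [comp_assoc _ _ _ hc (by simp), mul_inv_eq, ← hc, mul_s_self]

theorem eq_inv_of_mul {g h : G} (hc : s g = r h) (hu : g * h = s h) : g = h⁻¹ := by
  have := mul_inv_cancel_right' hc
  rw [hu] at this
  rw [← this]
  have h2 := r_mul_self h⁻¹
  rwa [r_inv] at h2

@[simp] theorem inv_inv' (g : G) : g⁻¹⁻¹ = g :=
  (eq_inv_of_mul (by simp) (by simp)).symm

theorem mul_inv_rev' {g h : G} (hc : s g = r h) : (g * h)⁻¹ = h⁻¹ * g⁻¹ := by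
  symm
  apply eq_inv_of_mul
  · rw [s_mul _ _ (by simpa using hc.symm), r_mul _ _ hc]; simp
  · rw [comp_assoc _ _ _ (by simpa using hc.symm) (by simp [r_mul _ _ hc]),
      mul_inv_cancel_left' hc, inv_mul_eq, s_mul _ _ hc]

variable (G) in
/-- The unit space `G⁰`. -/
def unitSpace : Set G := {u | r u = u}

theorem r_of_unit {u : G} (hu : u ∈ unitSpace G) : r u = u := hu

theorem s_of_unit {u : G} (hu : u ∈ unitSpace G) : s u = u := by
  rw [← r_of_unit hu, s_r]

theorem inv_of_unit {u : G} (hu : u ∈ unitSpace G) : u⁻¹ = u := by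
  have h := r_mul_self u⁻¹
  rw [r_inv, s_of_unit hu, mul_inv_eq, r_of_unit hu] at h
  exact h.symm

/-- The range map, as a map `G → G⁰`. -/
def rU (g : G) : unitSpace G := ⟨r g, r_r g⟩

/-- The source map, as a map `G → G⁰`. -/
def sU (g : G) : unitSpace G := ⟨s g, r_s g⟩

@[simp] theorem coe_rU (g : G) : (rU g : G) = r g := rfl

@[simp] theorem coe_sU (g : G) : (sU g : G) = s g := rfl

end Alg

/-- A locally compact Hausdorff groupoid: inversion is continuous, and multiplication is
continuous on the space of composable pairs. -/
class LCHGroupoid (G : Type*) [TopologicalSpace G] [ArrowGroupoid G] : Prop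
    extends T2Space G, LocallyCompactSpace G where
  continuous_inv' : Continuous fun g : G => g⁻¹
  continuousOn_mul : ContinuousOn (fun p : G × G => p.1 * p.2) {p | s p.1 = r p.2}

/-- An étale (locally compact Hausdorff) groupoid: range and source are local homeomorphisms onto
the unit space. -/
class EtaleGroupoid (G : Type*) [TopologicalSpace G] [ArrowGroupoid G] : Prop
    extends LCHGroupoid G where
  isLocalHomeomorph_r : IsLocalHomeomorph (rU : G → unitSpace G)
  isLocalHomeomorph_s : IsLocalHomeomorph (sU : G → unitSpace G)

open LCHGroupoid EtaleGroupoid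

section Top

variable {G : Type*} [TopologicalSpace G] [ArrowGroupoid G]

theorem continuous_r [LCHGroupoid G] : Continuous (r : G → G) := by
  have h : Continuous fun g : G => g * g⁻¹ :=
    continuousOn_mul.comp_continuous (continuous_id.prodMk continuous_inv') (by simp)
  simpa using h

theorem continuous_s [LCHGroupoid G] : Continuous (s : G → G) := by
  have h : Continuous fun g : G => r g⁻¹ := continuous_r.comp continuous_inv'
  simpa using h

theorem isOpen_unitSpace [EtaleGroupoid G] : IsOpen (unitSpace G) := by
  rw [isOpen_iff_mem_nhds]
  intro u hu
  obtain ⟨V, hV, hVu, hinj⟩ := (isLocalHomeomorph_r (G := G)).isLocallyInjective u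
  have h1 : V ∩ r ⁻¹' V ∈ 𝓝 u := by
    refine Filter.inter_mem (hV.mem_nhds hVu) (continuous_r.continuousAt.preimage_mem_nhds ?_)
    rw [r_of_unit hu]
    exact hV.mem_nhds hVu
  filter_upwards [h1] with g hg
  exact hinj hg.2 hg.1 (Subtype.ext (by simp))

end Top

/-! ### Open subgroupoids -/

/-- An open subgroupoid: an open set of arrows closed under products and inverses (hence under
range and source). -/
structure OpenSubgroupoid (G : Type*) [TopologicalSpace G] [ArrowGroupoid G] where
  carrier : Set G
  isOpen' : IsOpen carrier
  mul_mem' : ∀ g ∈ carrier, ∀ h ∈ carrier, s g = r h → g * h ∈ carrier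
  inv_mem' : ∀ g ∈ carrier, g⁻¹ ∈ carrier

namespace OpenSubgroupoid

variable {G : Type*} [TopologicalSpace G] [ArrowGroupoid G]

instance : SetLike (OpenSubgroupoid G) G where
  coe S := S.carrier
  coe_injective S T h := by
    cases S
    cases T
    congr

variable (S : OpenSubgroupoid G)

theorem isOpen : IsOpen (S : Set G) := S.isOpen'

variable {S}

theorem inv_mem {g : G} (hg : g ∈ S) : g⁻¹ ∈ S := S.inv_mem' g hg

theorem mul_mem {g h : G} (hg : g ∈ S) (hh : h ∈ S) (hc : s g = r h) : g * h ∈ S :=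
  S.mul_mem' g hg h hh hc

theorem r_mem {g : G} (hg : g ∈ S) : r g ∈ S := by
  rw [← mul_inv_eq]
  exact mul_mem hg (inv_mem hg) (by simp)

theorem s_mem {g : G} (hg : g ∈ S) : s g ∈ S := by
  rw [← inv_mul_eq]
  exact mul_mem (inv_mem hg) hg (by simp)

variable (S)

open Classical in
/-- The product of composable elements of `S` is their product in the ambient groupoid. -/
instance : Mul S where
  mul g h := if hc : s (g : G) = r (h : G) then ⟨g * h, mul_mem g.2 h.2 hc⟩ else g

instance : Inv S where
  inv g := ⟨(g : G)⁻¹, inv_mem g.2⟩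

@[simp] theorem coe_inv (g : S) : ((g⁻¹ : S) : G) = (g : G)⁻¹ := rfl

theorem coe_mul {g h : S} (hc : s (g : G) = r (h : G)) : ((g * h : S) : G) = g * h := by
  have : g * h = ⟨(g : G) * h, mul_mem g.2 h.2 hc⟩ := dif_pos hc
  rw [this]

instance : ArrowGroupoid S where
  r g := ⟨r (g : G), r_mem g.2⟩
  s g := ⟨s (g : G), s_mem g.2⟩
  r_r g := by simp
  s_r g := by simp
  r_s g := by simp
  s_s g := by simp
  r_mul g h hc := by
    have hc' : s (g : G) = r (h : G) := congrArg Subtype.val hc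
    simp [coe_mul S hc', r_mul _ _ hc']
  s_mul g h hc := by
    have hc' : s (g : G) = r (h : G) := congrArg Subtype.val hc
    simp [coe_mul S hc', s_mul _ _ hc']
  comp_assoc g h k hc hd := by
    have hc' : s (g : G) = r (h : G) := congrArg Subtype.val hc
    have hd' : s (h : G) = r (k : G) := congrArg Subtype.val hd
    apply Subtype.ext
    rw [coe_mul, coe_mul S hc', coe_mul, coe_mul S hd', comp_assoc _ _ _ hc' hd']
    · rw [coe_mul S hd', r_mul _ _ hd', hc']
    · rw [coe_mul S hc', s_mul _ _ hc', hd']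
  r_mul_self g := Subtype.ext (by rw [coe_mul] <;> simp)
  mul_s_self g := Subtype.ext (by rw [coe_mul] <;> simp)
  r_inv g := by simp
  s_inv g := by simp
  mul_inv_eq g := Subtype.ext (by rw [coe_mul] <;> simp)
  inv_mul_eq g := Subtype.ext (by rw [coe_mul] <;> simp)

@[simp] theorem coe_r (g : S) : ((r g : S) : G) = r (g : G) := rfl

@[simp] theorem coe_s (g : S) : ((s g : S) : G) = s (g : G) := rfl

theorem comp_coe {g h : S} (hc : s g = r h) : s (g : G) = r (h : G) := congrArg Subtype.val hc

instance [LCHGroupoid G] : LCHGroupoid S where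
  toLocallyCompactSpace := S.isOpen.locallyCompactSpace
  continuous_inv' :=
    Continuous.subtype_mk ((continuous_inv' (G := G)).comp continuous_subtype_val) _
  continuousOn_mul := by
    rw [IsInducing.subtypeVal.continuousOn_iff]
    have h : ContinuousOn (fun p : S × S => (p.1 : G) * (p.2 : G)) {p | s p.1 = r p.2} :=
      (continuousOn_mul (G := G)).comp (f := fun p : S × S => ((p.1 : G), (p.2 : G)))
        (by fun_prop) fun p hp => comp_coe S hp
    exact h.congr fun p hp => coe_mul S (comp_coe S hp)

theorem mem_unitSpace {u : S} : u ∈ unitSpace S ↔ (u : G) ∈ unitSpace G :=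
  Subtype.ext_iff

/-- The inclusion `S⁰ → G⁰`. -/
def unitIncl (u : unitSpace S) : unitSpace G := ⟨(u : S), (mem_unitSpace S).1 u.2⟩

theorem isOpenEmbedding_unitIncl : IsOpenEmbedding (unitIncl S) := by
  have h1 : IsEmbedding (Subtype.val ∘ unitIncl S) :=
    (IsEmbedding.subtypeVal (p := (· ∈ S))).comp (IsEmbedding.subtypeVal (p := (· ∈ unitSpace S)))
  refine ⟨IsEmbedding.of_comp ?_ continuous_subtype_val h1, ?_⟩
  · exact Continuous.subtype_mk (continuous_subtype_val.comp continuous_subtype_val) _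
  · have : range (unitIncl S) = Subtype.val ⁻¹' (S : Set G) := by
      ext u
      constructor
      · rintro ⟨v, rfl⟩
        exact (v : S).2
      · intro hu
        exact ⟨⟨⟨u, hu⟩, (mem_unitSpace S).2 u.2⟩, rfl⟩
    rw [this]
    exact S.isOpen.preimage continuous_subtype_val

instance [EtaleGroupoid G] : EtaleGroupoid S where
  isLocalHomeomorph_r := by
    have h1 : IsLocalHomeomorph (unitIncl S ∘ (rU : S → unitSpace S)) :=
      (isLocalHomeomorph_r (G := G)).comp S.isOpen.isOpenEmbedding_subtypeVal.isLocalHomeomorph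
    exact h1.of_comp (isOpenEmbedding_unitIncl S).isLocalHomeomorph
      (continuous_r.subtype_mk _)
  isLocalHomeomorph_s := by
    have h1 : IsLocalHomeomorph (unitIncl S ∘ (sU : S → unitSpace S)) :=
      (isLocalHomeomorph_s (G := G)).comp S.isOpen.isOpenEmbedding_subtypeVal.isLocalHomeomorph
    exact h1.of_comp (isOpenEmbedding_unitIncl S).isLocalHomeomorph
      (continuous_s.subtype_mk _)

end OpenSubgroupoid

/-! ### Twists -/

/-- A twist `G⁰ × 𝕋 → E → G` over `G`. Here `G⁰ × 𝕋` is the trivial bundle of groups over `G⁰`, so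
that `ι` is a groupoid homomorphism if `ι (u, z)` has range and source `ι (u, 1)`, and
`ι (u, z * w) = ι (u, z) * ι (u, w)`. -/
structure Twist (G E : Type*) [TopologicalSpace G] [ArrowGroupoid G] [TopologicalSpace E]
    [ArrowGroupoid E] where
  ι : unitSpace G × Circle → E
  π : E → G
  r_ι : ∀ u z, r (ι (u, z)) = ι (u, 1)
  s_ι : ∀ u z, s (ι (u, z)) = ι (u, 1)
  ι_mul : ∀ u z w, ι (u, z * w) = ι (u, z) * ι (u, w)
  /-- `ι` is continuous, and a homeomorphism onto its range -/
  isEmbedding_ι : IsEmbedding ι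
  π_r : ∀ e, π (r e) = r (π e)
  π_s : ∀ e, π (s e) = s (π e)
  π_mul : ∀ e f, s e = r f → π (e * f) = π e * π f
  continuous_π : Continuous π
  isOpenMap_π : IsOpenMap π
  surjective_π : Function.Surjective π
  /-- `π` restricts to a homeomorphism of the unit spaces -/
  isHomeomorph_unit : IsHomeomorph
    (MapsTo.restrict π (unitSpace E) (unitSpace G) fun e he =>
      (π_r e).symm.trans (congrArg π he))
  /-- the kernel of `π` is the range of `ι` -/
  range_ι : range ι = π ⁻¹' unitSpace G
  ι_one : ∀ e, ι (rU (π e), 1) = r e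
  /-- the extension is central -/
  central : ∀ e z, ι (rU (π e), z) * e = e * ι (sU (π e), z)

namespace Twist

variable {G E : Type*} [TopologicalSpace G] [ArrowGroupoid G] [TopologicalSpace E]
  [ArrowGroupoid E] (T : Twist G E)

attribute [simp] π_r π_s

/-- The action of the circle on `E`, `z · e = ι (r e, z) e`. -/
def act (z : Circle) (e : E) : E := T.ι (rU (T.π e), z) * e

theorem ι_one_s (e : E) : T.ι (sU (T.π e), 1) = s e := by
  have h := T.ι_one (s e)
  have h2 : rU (T.π (s e)) = sU (T.π e) := Subtype.ext (by simp)
  rwa [h2, r_s] at h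

theorem s_ι_r (e : E) (z : Circle) : s (T.ι (rU (T.π e), z)) = r e := by
  rw [T.s_ι, T.ι_one]

theorem r_ι_s (e : E) (z : Circle) : r (T.ι (sU (T.π e), z)) = s e := by
  rw [T.r_ι, T.ι_one_s]

theorem act_eq (z : Circle) (e : E) : T.act z e = e * T.ι (sU (T.π e), z) := T.central e z

@[simp] theorem r_act (z : Circle) (e : E) : r (T.act z e) = r e := by
  rw [act, r_mul _ _ (T.s_ι_r e z), T.r_ι, T.ι_one]

@[simp] theorem s_act (z : Circle) (e : E) : s (T.act z e) = s e := by
  rw [act, s_mul _ _ (T.s_ι_r e z)]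

theorem π_ι (u : unitSpace G) (z : Circle) : T.π (T.ι (u, z)) = u := by
  obtain ⟨e, he⟩ := T.surjective_π u
  have h1 : rU (T.π e) = u := Subtype.ext (by simp [he, r_of_unit u.2])
  have h2 : T.π (T.ι (u, z)) ∈ unitSpace G := by
    have : T.ι (u, z) ∈ range T.ι := mem_range_self _
    rwa [T.range_ι] at this
  rw [← r_of_unit h2, ← T.π_r, T.r_ι, ← h1, T.ι_one, T.π_r, coe_rU]

@[simp] theorem π_act (z : Circle) (e : E) : T.π (T.act z e) = T.π e := by
  rw [act, T.π_mul _ _ (T.s_ι_r e z), T.π_ι]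
  simp

@[simp] theorem π_inv (e : E) : T.π e⁻¹ = (T.π e)⁻¹ := by
  apply eq_inv_of_mul
  · rw [← T.π_s, ← T.π_r]; simp
  · rw [← T.π_mul _ _ (by simp), inv_mul_eq]; simp

theorem one_act (e : E) : T.act 1 e = e := by
  rw [act, T.ι_one, r_mul_self]

theorem act_mul {e f : E} (z : Circle) (hc : s e = r f) : T.act z e * f = T.act z (e * f) := by
  have h : rU (T.π (e * f)) = rU (T.π e) := Subtype.ext (by
    simp [T.π_mul _ _ hc, r_mul _ _ (show s (T.π e) = r (T.π f) by
      rw [← T.π_s, ← T.π_r, hc])])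
  rw [act, act, h, comp_assoc _ _ _ (T.s_ι_r e z) hc]

theorem mul_act {e f : E} (z : Circle) (hc : s e = r f) : e * T.act z f = T.act z (e * f) := by
  have h : sU (T.π (e * f)) = sU (T.π f) := Subtype.ext (by
    simp [T.π_mul _ _ hc, s_mul _ _ (show s (T.π e) = r (T.π f) by
      rw [← T.π_s, ← T.π_r, hc])])
  rw [act_eq, act_eq, h, comp_assoc _ _ _ hc (T.r_ι_s f z).symm]

theorem act_act (z w : Circle) (e : E) : T.act z (T.act w e) = T.act (z * w) e := by
  have h : rU (T.π (T.act w e)) = rU (T.π e) := Subtype.ext (by simp)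
  rw [act, h, act, act, T.ι_mul, comp_assoc _ _ _ (by rw [T.s_ι, T.r_ι]) (T.s_ι_r e w)]

theorem act_inv (z : Circle) (e : E) : (T.act z e)⁻¹ = T.act z⁻¹ e⁻¹ := by
  symm
  apply eq_inv_of_mul
  · simp
  · rw [T.mul_act _ (by simp), T.act_mul _ (by simp), T.act_act]
    simp [T.one_act]

theorem act_injective {z w : Circle} {e : E} (h : T.act z e = T.act w e) : z = w := by
  have h1 := congrArg (· * e⁻¹) h
  simp only [act] at h1
  rw [mul_inv_cancel_right' (T.s_ι_r e z), mul_inv_cancel_right' (T.s_ι_r e w)] at h1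
  exact (Prod.ext_iff.1 (T.isEmbedding_ι.injective h1)).2

theorem r_eq_of_π {e f : E} (h : r (T.π e) = r (T.π f)) : r e = r f := by
  have h2 := T.isHomeomorph_unit.injective
    (a₁ := rU e) (a₂ := rU f) (Subtype.ext (by
      change T.π (r e) = T.π (r f)
      simpa using h))
  exact congrArg Subtype.val h2

theorem s_eq_of_π {e f : E} (h : s (T.π e) = s (T.π f)) : s e = s f := by
  have h2 := T.r_eq_of_π (e := s e) (f := s f) (by simpa using h)
  simpa using h2

theorem comp_of_π {e f : E} (h : s (T.π e) = r (T.π f)) : s e = r f := by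
  have h2 := T.r_eq_of_π (e := s e) (f := f) (by simpa using h)
  simpa using h2

theorem π_comp {e f : E} (h : s e = r f) : s (T.π e) = r (T.π f) := by
  rw [← T.π_s, ← T.π_r, h]

theorem exists_act {e f : E} (h : T.π e = T.π f) : ∃ z, f = T.act z e := by
  have hr : r e = r f := T.r_eq_of_π (by rw [h])
  have hs : s e = s f := T.s_eq_of_π (by rw [h])
  have hm : f * e⁻¹ ∈ range T.ι := by
    rw [T.range_ι, mem_preimage, T.π_mul _ _ (by simpa using hs.symm), T.π_inv, h, mul_inv_eq]
    exact r_r _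
  obtain ⟨⟨u, z⟩, hz⟩ := hm
  have hu : u = rU (T.π e) := Subtype.ext (by
    rw [← T.π_ι u z, hz, T.π_mul _ _ (by simpa using hs.symm), T.π_inv, h, mul_inv_eq, coe_rU])
  refine ⟨z, ?_⟩
  rw [act, ← hu, hz, inv_mul_cancel_right' hs.symm]

/-- A set-theoretic section of `π`. -/
def sec (g : G) : E := Function.surjInv T.surjective_π g

@[simp] theorem π_sec (g : G) : T.π (T.sec g) = g := Function.surjInv_eq T.surjective_π g

theorem r_sec {g : G} {e : E} (h : r g = r (T.π e)) : r (T.sec g) = r e :=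
  T.r_eq_of_π (by simpa using h)

theorem s_sec {g : G} {e : E} (h : s g = s (T.π e)) : s (T.sec g) = s e :=
  T.s_eq_of_π (by simpa using h)

/-- `f (z · e) = z f(e)` for all `z ∈ 𝕋`, `e ∈ E`. -/
def Equivariant (f : E → ℂ) : Prop := ∀ (z : Circle) (e : E), f (T.act z e) = z * f e

/-- The convolution `(f * ξ)(e) = ∑_{g ∈ G^{r(e)}} f(σ(g)) ξ(σ(g)⁻¹ e)`, `σ = sec` being a section
of `π` (for equivariant `f`, `ξ` the choice of the section does not matter). -/
def conv (f ξ : E → ℂ) (e : E) : ℂ :=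
  ∑' g : {g : G // r g = r (T.π e)}, f (T.sec g) * ξ ((T.sec g)⁻¹ * e)

/-- The involution `f*(e) = conj f(e⁻¹)`. -/
def invol (_ : Twist G E) (f : E → ℂ) (e : E) : ℂ := starRingEnd ℂ (f e⁻¹)

/-- The compactly supported continuous equivariant functions, as a space of functions. -/
def ccSubmodule : Submodule ℂ (E → ℂ) where
  carrier := {f | Continuous f ∧ HasCompactSupport f ∧ T.Equivariant f}
  add_mem' := fun {f g} hf hg => ⟨hf.1.add hg.1, hf.2.1.add hg.2.1, fun z e => by
    rw [Pi.add_apply, hf.2.2, hg.2.2, Pi.add_apply]; ring⟩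
  zero_mem' := ⟨continuous_const, HasCompactSupport.zero, fun z e => by simp⟩
  smul_mem' := fun c f hf => ⟨hf.1.const_smul c, hf.2.1.smul_left (f := fun _ => c),
    fun z e => by rw [Pi.smul_apply, hf.2.2, Pi.smul_apply, smul_eq_mul, smul_eq_mul]; ring⟩

/-- `C_c(G;E)`. -/
def Cc : Type _ := T.ccSubmodule

/-- The equivariant functions in `C₀(E)`. -/
def c0Submodule : Submodule ℂ C₀(E, ℂ) where
  carrier := {f | T.Equivariant f}
  add_mem' := fun {f g} hf hg z e => by
    change f _ + g _ = z * (f e + g e)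
    rw [hf, hg]; ring
  zero_mem' := fun z e => by simp
  smul_mem' := fun c f hf z e => by
    change c * f _ = z * (c * f e)
    rw [hf]; ring

/-- `C_0(G;E)`, with the supremum norm. -/
def C0 : Type _ := T.c0Submodule

variable {T}

theorem Equivariant.norm_eq {f : E → ℂ} (hf : T.Equivariant f) {e e' : E} (h : T.π e = T.π e') :
    ‖f e‖ = ‖f e'‖ := by
  obtain ⟨z, rfl⟩ := T.exists_act h
  rw [hf, norm_mul, Circle.norm_coe, one_mul]

theorem Equivariant.eq_zero_iff {f : E → ℂ} (hf : T.Equivariant f) {e e' : E}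
    (h : T.π e = T.π e') : f e = 0 ↔ f e' = 0 := by
  rw [← norm_eq_zero, hf.norm_eq h, norm_eq_zero]

/-- The summand in a convolution only depends on the class of `a` in `G`. -/
theorem Equivariant.term_eq {f ξ : E → ℂ} (hf : T.Equivariant f) (hξ : T.Equivariant ξ)
    {a b e : E} (h : T.π a = T.π b) (hr : r a = r e) :
    f a * ξ (a⁻¹ * e) = f b * ξ (b⁻¹ * e) := by
  obtain ⟨z, rfl⟩ := T.exists_act h
  rw [T.act_inv, T.act_mul _ (by simpa using hr), hf, hξ]
  have hz : (z : ℂ) * ((z⁻¹ : Circle) : ℂ) = 1 := by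
    rw [← Circle.coe_mul]; simp
  linear_combination (-(f a * ξ (a⁻¹ * e))) * hz

/-- The bijection `g ↦ g⁻¹ k` from `G^{r(k)}` to `G_{s(k)}`. -/
def fiberEquiv (k : G) {u : G} (hu : s k = u) : {g : G // r g = r k} ≃ {h : G // s h = u} where
  toFun g := ⟨(g : G)⁻¹ * k, by rw [s_mul _ _ (by simp [g.2]), hu]⟩
  invFun h := ⟨k * (h : G)⁻¹, by rw [r_mul _ _ (by simp [h.2, hu])]⟩
  left_inv g := Subtype.ext (by
    change k * ((g : G)⁻¹ * k)⁻¹ = g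
    rw [mul_inv_rev' (by simp [g.2]), inv_inv', inv_mul_cancel_left' (by simp [g.2])])
  right_inv h := Subtype.ext (by
    change (k * (h : G)⁻¹)⁻¹ * k = h
    rw [mul_inv_rev' (by simp [h.2, hu]), inv_inv', inv_mul_cancel_right' (by simp [h.2, hu])])

theorem conv_term_eq {f ξ : E → ℂ} (hf : T.Equivariant f) (hξ : T.Equivariant ξ) {e : E} {u : G}
    (hu : s (T.π e) = u) (g : {g : G // r g = r (T.π e)}) :
    f (T.sec g) * ξ ((T.sec g)⁻¹ * e) =
      f (e * (T.sec (fiberEquiv (T.π e) hu g))⁻¹) * ξ (T.sec (fiberEquiv (T.π e) hu g)) := by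
  set h := fiberEquiv (T.π e) hu g with hh
  have hs : s (T.sec h) = s e := T.s_sec (by rw [h.2, hu])
  have hg : (g : G) = T.π e * (h : G)⁻¹ :=
    congrArg Subtype.val ((fiberEquiv (T.π e) hu).symm_apply_apply g).symm
  rw [hf.term_eq hξ (b := e * (T.sec h)⁻¹) _ (T.r_sec g.2)]
  · rw [mul_inv_rev' (by simp [hs]), inv_inv', inv_mul_cancel_right' (by simp [hs])]
  · rw [T.π_mul _ _ (by simp [hs]), T.π_inv, T.π_sec, T.π_sec, hg]

/-- The convolution in terms of the kernel `f (e σ(h)⁻¹)`. -/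
theorem conv_eq {f ξ : E → ℂ} (hf : T.Equivariant f) (hξ : T.Equivariant ξ) {e : E} {u : G}
    (hu : s (T.π e) = u) :
    T.conv f ξ e = ∑' h : {h : G // s h = u}, f (e * (T.sec h)⁻¹) * ξ (T.sec h) := by
  rw [conv, ← (fiberEquiv (T.π e) hu).tsum_eq]
  exact tsum_congr fun g => conv_term_eq hf hξ hu g

theorem conv_eq_of_r {f ξ : E → ℂ} {e : E} {v : G} (hv : r (T.π e) = v) :
    T.conv f ξ e = ∑' g : {g : G // r g = v}, f (T.sec g) * ξ ((T.sec g)⁻¹ * e) := by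
  subst hv
  rfl

end Twist

/-! ### The Hilbert spaces `ℓ²(G_u;E_u)` -/

/-- A discrete Schur test: matrices with bounded entries and a bounded number of non-zero entries
in each row and column are bounded on `ℓ²`. -/
theorem schur {I : Type*} (A : I → I → ℂ) (M : ℝ≥0∞) (n : ℕ) (hM : ∀ i j, ‖A i j‖ₑ ≤ M)
    (c : I → I → Fin n)
    (hrow : ∀ i j j', A i j ≠ 0 → A i j' ≠ 0 → c i j = c i j' → j = j')
    (hcol : ∀ i i' j, A i j ≠ 0 → A i' j ≠ 0 → c i j = c i' j → i = i')
    (x : I → ℂ) :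
    ∑' i, ‖∑' j, A i j * x j‖ₑ ^ 2 ≤ (n * M) ^ 2 * ∑' j, ‖x j‖ₑ ^ 2 := by
  classical
  have hcard : ∀ (p : I → Prop) [DecidablePred p] (d : I → Fin n), (∀ i i', p i → p i' → d i = d i' → i = i') →
      ∀ t : Finset I, (t.filter p).card ≤ n := by
    intro p _ d hd t
    calc (t.filter p).card ≤ (Finset.univ : Finset (Fin n)).card :=
          Finset.card_le_card_of_injOn d (fun _ _ => Finset.mem_coe.2 (Finset.mem_univ _))
            fun i hi i' hi' h => hd i i' (Finset.mem_filter.1 hi).2 (Finset.mem_filter.1 hi').2 h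
      _ = n := by simp
  have hcount : ∀ (p : I → Prop) [DecidablePred p] (d : I → Fin n), (∀ i i', p i → p i' → d i = d i' → i = i') →
      ∑' i, (if p i then (1 : ℝ≥0∞) else 0) ≤ n := by
    intro p _ d hd
    rw [ENNReal.tsum_eq_iSup_sum]
    refine iSup_le fun t => ?_
    rw [Finset.sum_boole]
    exact_mod_cast hcard p d hd t
  have hrow2 : ∀ i, ‖∑' j, A i j * x j‖ₑ ^ 2 ≤
      n * M ^ 2 * ∑' j, (if A i j ≠ 0 then (1 : ℝ≥0∞) else 0) * ‖x j‖ₑ ^ 2 := by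
    intro i
    have hfin : {j | A i j ≠ 0}.Finite :=
      Set.Finite.of_injOn (f := c i) (t := Set.univ) (fun _ _ => mem_univ _)
        (fun j hj j' hj' h => hrow i j j' hj hj' h) Set.finite_univ
    set F := hfin.toFinset with hF
    have hFmem : ∀ j, j ∈ F ↔ A i j ≠ 0 := fun j => by simp [hF]
    have hFcard : F.card ≤ n := by
      have := hcard (fun j => A i j ≠ 0) (c i) (fun j j' => hrow i j j') F
      have h5 : F.filter (fun j => A i j ≠ 0) = F :=
        Finset.filter_true_of_mem fun j hj => (hFmem j).1 hj
      rwa [h5] at this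
    have h1 : ∑' j, A i j * x j = ∑ j ∈ F, A i j * x j :=
      tsum_eq_sum fun j hj => by
        have : A i j = 0 := by
          by_contra h
          exact hj ((hFmem j).2 h)
        simp [this]
    have h2 : ∑' j, (if A i j ≠ 0 then (1 : ℝ≥0∞) else 0) * ‖x j‖ₑ ^ 2 = ∑ j ∈ F, ‖x j‖ₑ ^ 2 := by
      rw [tsum_eq_sum (s := F) fun j hj => by
        rw [if_neg fun h => hj ((hFmem j).2 h), zero_mul]]
      exact Finset.sum_congr rfl fun j hj => by rw [if_pos ((hFmem j).1 hj), one_mul]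
    have h3 : ‖∑' j, A i j * x j‖ₑ ≤ M * ∑ j ∈ F, ‖x j‖ₑ := by
      rw [h1, Finset.mul_sum]
      refine (enorm_sum_le _ _).trans (Finset.sum_le_sum fun j _ => ?_)
      rw [enorm_mul]
      gcongr
      exact hM i j
    have h4 : (∑ j ∈ F, ‖x j‖ₑ) ^ 2 ≤ F.card * ∑ j ∈ F, ‖x j‖ₑ ^ 2 := by
      have := ENNReal.rpow_sum_le_const_mul_sum_rpow F (fun j => ‖x j‖ₑ) (p := 2) (by norm_num)
      norm_num at this
      exact_mod_cast this
    calc ‖∑' j, A i j * x j‖ₑ ^ 2 ≤ (M * ∑ j ∈ F, ‖x j‖ₑ) ^ 2 := by gcongr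
      _ = M ^ 2 * (∑ j ∈ F, ‖x j‖ₑ) ^ 2 := by rw [mul_pow]
      _ ≤ M ^ 2 * (F.card * ∑ j ∈ F, ‖x j‖ₑ ^ 2) := by gcongr
      _ ≤ M ^ 2 * (n * ∑ j ∈ F, ‖x j‖ₑ ^ 2) := by gcongr
      _ = _ := by rw [h2]; ring
  calc ∑' i, ‖∑' j, A i j * x j‖ₑ ^ 2
      ≤ ∑' i, n * M ^ 2 * ∑' j, (if A i j ≠ 0 then (1 : ℝ≥0∞) else 0) * ‖x j‖ₑ ^ 2 :=
        ENNReal.tsum_le_tsum hrow2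
    _ = n * M ^ 2 * ∑' j, (∑' i, (if A i j ≠ 0 then (1 : ℝ≥0∞) else 0)) * ‖x j‖ₑ ^ 2 := by
        rw [ENNReal.tsum_mul_left, ENNReal.tsum_comm]
        simp_rw [ENNReal.tsum_mul_right]
    _ ≤ n * M ^ 2 * ∑' j, n * ‖x j‖ₑ ^ 2 := by
        gcongr with j
        exact hcount (fun i => A i j ≠ 0) (fun i => c i j) fun i i' => hcol i i' j
    _ = _ := by rw [ENNReal.tsum_mul_left]; ring

namespace Twist

variable {G E : Type*} [TopologicalSpace G] [ArrowGroupoid G] [TopologicalSpace E]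
  [ArrowGroupoid E] (T : Twist G E)

/-- The functions `ξ : E_u → ℂ` with `ξ(z · e) = z ξ(e)` and `∑_{g ∈ G_u} |ξ(σ(g))|² < ∞`;
functions on `E_u = {e | s e = u}` are represented by functions on `E` that vanish off `E_u`. -/
def ell2Submodule (u : unitSpace G) : Submodule ℂ (E → ℂ) where
  carrier := {ξ | (∀ e, s (T.π e) ≠ u → ξ e = 0) ∧ T.Equivariant ξ ∧
    Memℓp (fun g : {g : G // s g = u} => ξ (T.sec g)) 2}
  add_mem' := fun {ξ η} hξ hη => ⟨fun e he => by simp [hξ.1 e he, hη.1 e he],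
    fun z e => by rw [Pi.add_apply, hξ.2.1, hη.2.1, Pi.add_apply]; ring, hξ.2.2.add hη.2.2⟩
  zero_mem' := ⟨fun _ _ => rfl, fun z e => by simp, zero_memℓp⟩
  smul_mem' := fun c ξ hξ => ⟨fun e he => by simp [hξ.1 e he],
    fun z e => by rw [Pi.smul_apply, hξ.2.1, Pi.smul_apply, smul_eq_mul, smul_eq_mul]; ring,
    hξ.2.2.const_smul c⟩

/-- The Hilbert space `ℓ²(G_u;E_u)`. -/
def Ell2 (u : unitSpace G) : Type _ := T.ell2Submodule u

variable {T} {u : unitSpace G}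

namespace Ell2

instance : AddCommGroup (T.Ell2 u) := inferInstanceAs (AddCommGroup (T.ell2Submodule u))

instance : Module ℂ (T.Ell2 u) := inferInstanceAs (Module ℂ (T.ell2Submodule u))

instance : CoeFun (T.Ell2 u) fun _ => E → ℂ := ⟨fun ξ => ξ.1⟩

theorem ext {ξ η : T.Ell2 u} (h : ∀ e, ξ e = η e) : ξ = η := Subtype.ext (funext h)

@[simp] theorem add_apply (ξ η : T.Ell2 u) (e : E) : (ξ + η) e = ξ e + η e := rfl

@[simp] theorem smul_apply (c : ℂ) (ξ : T.Ell2 u) (e : E) : (c • ξ) e = c * ξ e := rfl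

theorem eq_zero (ξ : T.Ell2 u) {e : E} (h : s (T.π e) ≠ u) : ξ e = 0 := ξ.2.1 e h

theorem equivariant (ξ : T.Ell2 u) : T.Equivariant ξ := ξ.2.2.1

variable (T u) in
/-- Evaluation at the points `σ(g)`, `g ∈ G_u`. -/
def toLp : T.Ell2 u →ₗ[ℂ] lp (fun _ : {g : G // s g = u} => ℂ) 2 where
  toFun ξ := ⟨fun g => ξ (T.sec g), ξ.2.2.2⟩
  map_add' _ _ := rfl
  map_smul' _ _ := rfl

@[simp] theorem toLp_apply (ξ : T.Ell2 u) (g : {g : G // s g = u}) :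
    toLp T u ξ g = ξ (T.sec g) := rfl

theorem toLp_injective : Function.Injective (toLp T u) := by
  intro ξ η h
  refine ext fun e => ?_
  by_cases he : s (T.π e) = u
  · obtain ⟨z, hz⟩ := T.exists_act (e := T.sec (T.π e)) (f := e) (by simp)
    have h1 : ξ (T.sec (T.π e)) = η (T.sec (T.π e)) := by
      rw [← toLp_apply ξ ⟨T.π e, he⟩, h, toLp_apply]
    rw [hz, ξ.equivariant, η.equivariant, h1]
  · rw [ξ.eq_zero he, η.eq_zero he]

theorem toLp_surjective : Function.Surjective (toLp T u) := by
  classical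
  intro x
  choose z hz using fun e : E => T.exists_act (e := T.sec (T.π e)) (f := e) (by simp)
  have hzu : ∀ (e : E) (w : Circle) (g : G), e = T.act w (T.sec g) → w = z e := by
    intro e w g hw
    have hg : T.π e = g := by rw [hw]; simp
    have h1 := hz e
    rw [hg] at h1
    exact T.act_injective (hw.symm.trans h1)
  obtain ⟨ξ, hξ1, hξ0⟩ : ∃ ξ : E → ℂ, (∀ e (he : s (T.π e) = u), ξ e = z e * x ⟨T.π e, he⟩) ∧
      ∀ e, s (T.π e) ≠ u → ξ e = 0 :=
    ⟨fun e => if he : s (T.π e) = u then z e * x ⟨T.π e, he⟩ else 0,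
      fun e he => dif_pos he, fun e he => dif_neg he⟩
  have key : ∀ g : {g : G // s g = u}, ξ (T.sec g) = x g := by
    intro g
    have he : s (T.π (T.sec g)) = u := by simpa using g.2
    have h2 : (⟨T.π (T.sec g), he⟩ : {g : G // s g = u}) = g := Subtype.ext (by simp)
    have h3 : 1 = z (T.sec g) := hzu _ 1 g (T.one_act _).symm
    rw [hξ1 _ he, h2, ← h3, Circle.coe_one, one_mul]
  refine ⟨⟨ξ, hξ0, ?_, ?_⟩, ?_⟩
  · intro w e
    have h1 : w * z e = z (T.act w e) := by
      refine hzu _ _ (T.π e) ?_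
      rw [← T.act_act, ← hz e]
    by_cases he : s (T.π e) = u
    · have he' : s (T.π (T.act w e)) = u := by simpa using he
      have h2 : (⟨T.π (T.act w e), he'⟩ : {g : G // s g = u}) = ⟨T.π e, he⟩ :=
        Subtype.ext (by simp)
      rw [hξ1 _ he, hξ1 _ he', h2, ← h1, Circle.coe_mul, mul_assoc]
    · have he' : ¬ s (T.π (T.act w e)) = u := by simpa using he
      rw [hξ0 _ he, hξ0 _ he', mul_zero]
  · simp_rw [key]
    exact x.2
  · ext g
    exact key g

instance : NormedAddCommGroup (T.Ell2 u) :=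
  NormedAddCommGroup.induced _ _ (toLp T u) toLp_injective

theorem norm_toLp (ξ : T.Ell2 u) : ‖toLp T u ξ‖ = ‖ξ‖ := rfl

instance : InnerProductSpace ℂ (T.Ell2 u) where
  norm_smul_le c ξ := by
    rw [← norm_toLp, map_smul, norm_smul, norm_toLp]
  inner ξ η := inner ℂ (toLp T u ξ) (toLp T u η)
  norm_sq_eq_re_inner ξ := by
    rw [← norm_toLp, norm_sq_eq_re_inner (𝕜 := ℂ)]
  conj_inner_symm ξ η := inner_conj_symm _ _
  add_left ξ η ζ := by rw [map_add, inner_add_left]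
  smul_left ξ η c := by rw [map_smul, inner_smul_left]

/-- The inner product is `∑_{g ∈ G_u} ξ(σ(g)) conj (η(σ(g)))`; it is linear in `ξ` (in Mathlib,
inner products are linear in the second variable). -/
theorem inner_eq_tsum (ξ η : T.Ell2 u) :
    inner ℂ η ξ = ∑' g : {g : G // s g = u}, ξ (T.sec g) * starRingEnd ℂ (η (T.sec g)) := by
  change inner ℂ (toLp T u η) (toLp T u ξ) = _
  rw [lp.inner_eq_tsum]
  simp

variable (T u) in
/-- `ℓ²(G_u;E_u)` is isometric to `ℓ²(G_u)`. -/
def equivLp : T.Ell2 u ≃ₗᵢ[ℂ] lp (fun _ : {g : G // s g = u} => ℂ) 2 where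
  toLinearEquiv := LinearEquiv.ofBijective (toLp T u) ⟨toLp_injective, toLp_surjective⟩
  norm_map' := norm_toLp

instance : CompleteSpace (T.Ell2 u) :=
  (equivLp T u).toIsometryEquiv.completeSpace

theorem enorm_sq (ξ : T.Ell2 u) :
    ‖ξ‖ₑ ^ 2 = ∑' g : {g : G // s g = u}, ‖ξ (T.sec g)‖ₑ ^ 2 := by
  have h := lp.norm_rpow_eq_tsum (p := 2) (by norm_num) (toLp T u ξ)
  have hs := (lp.memℓp (toLp T u ξ)).summable (by norm_num)
  norm_num at h hs
  rw [norm_toLp] at h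
  rw [← ofReal_norm, ← ENNReal.ofReal_pow (norm_nonneg _), h, ENNReal.ofReal_tsum_of_nonneg
    (fun _ => by positivity) hs]
  refine tsum_congr fun g => ?_
  rw [← ofReal_norm, ← ENNReal.ofReal_pow (norm_nonneg _)]

end Ell2

end Twist

/-! ### The regular representations and the reduced C*-algebra -/

open LCHGroupoid EtaleGroupoid

/-- A compact subset of an étale groupoid is covered by finitely many bisections. -/
theorem exists_coloring {G : Type*} [TopologicalSpace G] [ArrowGroupoid G] [EtaleGroupoid G]
    {K : Set G} (hK : IsCompact K) : ∃ (n : ℕ) (c : G → Fin n), ∀ g ∈ K, ∀ h ∈ K, c g = c h →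
      (r g = r h → g = h) ∧ (s g = s h → g = h) := by
  classical
  have h1 : ∀ x : G, ∃ U ∈ 𝓝 x, ∀ g ∈ U, ∀ h ∈ U,
      (r g = r h → g = h) ∧ (s g = s h → g = h) := by
    intro x
    obtain ⟨V, hV, hx, hVi⟩ := (isLocalHomeomorph_r (G := G)).isLocallyInjective x
    obtain ⟨W, hW, hy, hWi⟩ := (isLocalHomeomorph_s (G := G)).isLocallyInjective x
    exact ⟨V ∩ W, Filter.inter_mem (hV.mem_nhds hx) (hW.mem_nhds hy), fun g hg h hh =>
      ⟨fun e => hVi hg.1 hh.1 (Subtype.ext e), fun e => hWi hg.2 hh.2 (Subtype.ext e)⟩⟩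
  choose U hU hUi using h1
  obtain ⟨t, -, ht⟩ := hK.elim_nhds_subcover U fun x _ => hU x
  refine ⟨t.card + 1, fun g => if h : ∃ x : t, g ∈ U x then
    (t.equivFin h.choose).castSucc else Fin.last _, fun g hg h hh hc => ?_⟩
  simp only at hc
  have hg' : ∃ x : t, g ∈ U x := by simpa using ht hg
  have hh' : ∃ x : t, h ∈ U x := by simpa using ht hh
  rw [dif_pos hg', dif_pos hh'] at hc
  have hc' := t.equivFin.injective (Fin.castSucc_injective _ hc)
  exact hUi _ g hg'.choose_spec h (hc' ▸ hh'.choose_spec)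

namespace Twist

variable {G E : Type*} [TopologicalSpace G] [ArrowGroupoid G] [TopologicalSpace E]
  [ArrowGroupoid E] {T : Twist G E}

theorem conv_smul_right (c : ℂ) (f ξ : E → ℂ) :
    T.conv f (c • ξ) = c • T.conv f ξ := by
  ext e
  simp only [conv, Pi.smul_apply, smul_eq_mul, ← tsum_mul_left]
  exact tsum_congr fun g => by ring

theorem conv_smul_left (c : ℂ) (f ξ : E → ℂ) :
    T.conv (c • f) ξ = c • T.conv f ξ := by
  ext e
  simp only [conv, Pi.smul_apply, smul_eq_mul, ← tsum_mul_left]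
  exact tsum_congr fun g => by ring

theorem conv_equivariant (f : E → ℂ) {ξ : E → ℂ}
    (hξ : T.Equivariant ξ) : T.Equivariant (T.conv f ξ) := by
  intro z e
  rw [conv, T.π_act, conv, ← tsum_mul_left]
  refine tsum_congr fun g => ?_
  rw [T.mul_act _ (by simpa using T.r_sec g.2), hξ]
  ring

namespace Cc

instance : AddCommGroup T.Cc := inferInstanceAs (AddCommGroup T.ccSubmodule)

instance : Module ℂ T.Cc := inferInstanceAs (Module ℂ T.ccSubmodule)

instance : FunLike T.Cc E ℂ where
  coe f := f.1
  coe_injective _ _ h := Subtype.ext h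

@[ext] theorem ext {f g : T.Cc} (h : ∀ e, f e = g e) : f = g := DFunLike.ext f g h

@[simp] theorem mk_apply f (hf : f ∈ T.ccSubmodule) (e : E) :
    (show T.Cc from ⟨f, hf⟩) e = f e := rfl

@[simp] theorem coe_add (f g : T.Cc) : ⇑(f + g) = f + g := rfl

@[simp] theorem coe_smul (c : ℂ) (f : T.Cc) : ⇑(c • f) = c • ⇑f := rfl

theorem continuous (f : T.Cc) : Continuous (f : E → ℂ) := f.2.1

theorem hasCompactSupport (f : T.Cc) : HasCompactSupport (f : E → ℂ) := f.2.2.1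

theorem equivariant (f : T.Cc) : T.Equivariant (f : E → ℂ) := f.2.2.2

variable [EtaleGroupoid G]

theorem exists_coloring (f : T.Cc) : ∃ (n : ℕ) (c : G → Fin n), ∀ e e' : E,
    f e ≠ 0 → f e' ≠ 0 → c (T.π e) = c (T.π e') →
      (r (T.π e) = r (T.π e') → T.π e = T.π e') ∧
      (s (T.π e) = s (T.π e') → T.π e = T.π e') := by
  obtain ⟨n, c, hc⟩ := TwistedGroupoid.exists_coloring
    (f.hasCompactSupport.isCompact.image T.continuous_π)
  exact ⟨n, c, fun e e' he he' => hc _ (mem_image_of_mem _ (subset_tsupport _ he)) _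
    (mem_image_of_mem _ (subset_tsupport _ he'))⟩

theorem finite_row (f : T.Cc) (u : G) :
    {g : {g : G // r g = u} | f (T.sec g) ≠ 0}.Finite := by
  obtain ⟨n, c, hc⟩ := f.exists_coloring
  refine Set.Finite.of_injOn (f := fun g : {g : G // r g = u} => c (g : G)) (t := Set.univ) (fun _ _ => mem_univ _) ?_
    Set.finite_univ
  intro g hg h hh e
  have := (hc _ _ hg hh (by simpa using e)).1 (by simp [g.2, h.2])
  exact Subtype.ext (by simpa using this)

theorem summable_conv (f : T.Cc) (ξ : E → ℂ) (e : E) :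
    Summable fun g : {g : G // r g = r (T.π e)} =>
      f (T.sec g) * ξ ((T.sec g)⁻¹ * e) :=
  summable_of_hasFiniteSupport ((f.finite_row _).subset fun g hg h => hg (by simp [h]))

theorem conv_add_right (f : T.Cc) (ξ η : E → ℂ) :
    T.conv f (ξ + η) = T.conv f ξ + T.conv f η := by
  ext e
  simp only [conv, Pi.add_apply, mul_add]
  exact (f.summable_conv ξ e).tsum_add (f.summable_conv η e)

theorem conv_add_left (f g : T.Cc) (ξ : E → ℂ) :
    T.conv (f + g : T.Cc) ξ = T.conv f ξ + T.conv g ξ := by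
  ext e
  simp only [conv, Pi.add_apply, coe_add, add_mul]
  exact (f.summable_conv ξ e).tsum_add (g.summable_conv ξ e)

theorem exists_bound (f : T.Cc) : ∃ C : NNReal, ∀ (u : unitSpace G) (ξ : T.Ell2 u),
    ∑' g : {g : G // s g = u}, ‖T.conv f ξ (T.sec g)‖ₑ ^ 2 ≤ ((C : ℝ≥0∞) * ‖ξ‖ₑ) ^ 2 := by
  obtain ⟨n, c, hc⟩ := f.exists_coloring
  obtain ⟨M, hM⟩ := f.hasCompactSupport.exists_bound_of_continuous f.continuous
  have hM' : ∀ e, ‖f e‖ₑ ≤ (M.toNNReal : ℝ≥0∞) := fun e => by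
    rw [← ofReal_norm]
    exact ENNReal.ofReal_le_ofReal (hM e)
  refine ⟨n * M.toNNReal, fun u ξ => ?_⟩
  have hcomp : ∀ g h : {g : G // s g = u}, s (T.sec (g : G)) = s (T.sec (h : G)) := fun g h =>
    T.s_eq_of_π (by simp [g.2, h.2])
  have hπ : ∀ g h : {g : G // s g = u}, T.π (T.sec g * (T.sec h)⁻¹) = g * (h : G)⁻¹ :=
    fun g h => by rw [T.π_mul _ _ (by simp [hcomp g h])]; simp
  have key := schur (fun g h : {g : G // s g = u} => f (T.sec g * (T.sec h)⁻¹))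
    M.toNNReal n (fun _ _ => hM' _) (fun g h => c (g * (h : G)⁻¹)) ?_ ?_ fun h => ξ (T.sec h)
  · rw [mul_pow, Ell2.enorm_sq]
    push_cast
    refine le_of_eq_of_le (tsum_congr fun g => ?_) key
    rw [conv_eq f.equivariant ξ.equivariant (u := u) (by simpa using g.2)]
  · intro g h h' hh hh' e
    have h1 := (hc _ _ hh hh' (by rw [hπ, hπ]; exact e)).1 (by
      rw [hπ, hπ, r_mul _ _ (by simp [g.2, h.2]), r_mul _ _ (by simp [g.2, h'.2])])
    rw [hπ, hπ] at h1
    have h2 : ((h : G)⁻¹) = (h' : G)⁻¹ := by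
      rw [← mul_inv_cancel_left' (g := (g : G)) (h := (h : G)⁻¹) (by simp [g.2, h.2]), h1,
        mul_inv_cancel_left' (by simp [g.2, h'.2])]
    exact Subtype.ext (by rw [← inv_inv' (h : G), h2, inv_inv'])
  · intro g g' h hh hh' e
    have h1 := (hc _ _ hh hh' (by rw [hπ, hπ]; exact e)).2 (by
      rw [hπ, hπ, s_mul _ _ (by simp [g.2, h.2]), s_mul _ _ (by simp [g'.2, h.2])])
    rw [hπ, hπ] at h1
    exact Subtype.ext (by
      rw [← inv_mul_cancel_right' (g := (g : G)) (h := h) (by simp [g.2, h.2]), h1,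
        inv_mul_cancel_right' (by simp [g'.2, h.2])])

theorem conv_mem_ell2 (f : T.Cc) {u : unitSpace G} (ξ : T.Ell2 u) :
    T.conv f ξ ∈ T.ell2Submodule u := by
  obtain ⟨C, hC⟩ := f.exists_bound
  refine ⟨fun e he => ?_, conv_equivariant _ ξ.equivariant, ?_⟩
  · have : ∀ g : {g : G // r g = r (T.π e)},
        f (T.sec g) * ξ ((T.sec g)⁻¹ * e) = 0 := fun g => by
      rw [ξ.eq_zero, mul_zero]
      rwa [← T.π_s, s_mul _ _ (by simpa using T.r_sec g.2), T.π_s]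
    simp [conv, this]
  · have h1 := (hC u ξ).trans_lt (ENNReal.pow_lt_top
      (ENNReal.mul_lt_top ENNReal.coe_lt_top enorm_lt_top))
    refine memℓp_gen ?_
    have h2 := ENNReal.summable_toReal h1.ne
    simpa using h2

/-- `θ_u(f) ξ = f * ξ`, as a linear map. -/
def thetaLin (f : T.Cc) (u : unitSpace G) : T.Ell2 u →ₗ[ℂ] T.Ell2 u where
  toFun ξ := ⟨T.conv f ξ, f.conv_mem_ell2 ξ⟩
  map_add' ξ η := Subtype.ext (f.conv_add_right ξ η)
  map_smul' c ξ := Subtype.ext (conv_smul_right c f ξ)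

theorem exists_bound_thetaLin (f : T.Cc) : ∃ C : ℝ, 0 ≤ C ∧ ∀ (u : unitSpace G) (ξ : T.Ell2 u),
    ‖f.thetaLin u ξ‖ ≤ C * ‖ξ‖ := by
  obtain ⟨C, hC⟩ := f.exists_bound
  refine ⟨C, C.2, fun u ξ => ?_⟩
  have h1 : ‖f.thetaLin u ξ‖ₑ ^ 2 ≤ ((C : ℝ≥0∞) * ‖ξ‖ₑ) ^ 2 := by
    rw [Ell2.enorm_sq]
    exact hC u ξ
  have h2 : ‖f.thetaLin u ξ‖ₑ ≤ (C : ℝ≥0∞) * ‖ξ‖ₑ := by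
    rwa [ENNReal.pow_le_pow_left_iff two_ne_zero] at h1
  rw [enorm_eq_nnnorm, enorm_eq_nnnorm] at h2
  exact_mod_cast h2

/-- The regular representation `θ_u(f) ξ = f * ξ` on `ℓ²(G_u;E_u)`. -/
def theta (f : T.Cc) (u : unitSpace G) : T.Ell2 u →L[ℂ] T.Ell2 u :=
  (f.thetaLin u).mkContinuous (Classical.choose f.exists_bound_thetaLin)
    ((Classical.choose_spec f.exists_bound_thetaLin).2 u)

@[simp] theorem theta_apply (f : T.Cc) (u : unitSpace G) (ξ : T.Ell2 u) (e : E) :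
    f.theta u ξ e = T.conv f ξ e := rfl

theorem memℓp_theta (f : T.Cc) : Memℓp (fun u => f.theta u) ∞ := by
  rw [memℓp_infty_iff]
  refine ⟨Classical.choose f.exists_bound_thetaLin, ?_⟩
  rintro _ ⟨u, rfl⟩
  exact LinearMap.mkContinuous_norm_le _ (Classical.choose_spec f.exists_bound_thetaLin).1 _

end Cc

variable (T) in
/-- The C*-algebra `∏_{u ∈ G⁰} B(ℓ²(G_u;E_u))` of bounded families, with the supremum norm. -/
def BddFamilies : Type _ := lp (fun u : unitSpace G => T.Ell2 u →L[ℂ] T.Ell2 u) ∞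

namespace BddFamilies

instance : NonUnitalCStarAlgebra T.BddFamilies :=
  inferInstanceAs (NonUnitalCStarAlgebra (lp (fun u : unitSpace G => T.Ell2 u →L[ℂ] T.Ell2 u) ∞))

/-- The component at `u` of a bounded family. -/
def at' (a : T.BddFamilies) (u : unitSpace G) : T.Ell2 u →L[ℂ] T.Ell2 u := a.1 u

@[ext] theorem ext {a b : T.BddFamilies} (h : ∀ u, a.at' u = b.at' u) : a = b :=
  Subtype.ext (funext h)

@[simp] theorem add_at (a b : T.BddFamilies) (u : unitSpace G) :
    (a + b).at' u = a.at' u + b.at' u := rfl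

@[simp] theorem smul_at (c : ℂ) (a : T.BddFamilies) (u : unitSpace G) :
    (c • a).at' u = c • a.at' u := rfl

@[simp] theorem mul_at (a b : T.BddFamilies) (u : unitSpace G) :
    (a * b).at' u = a.at' u * b.at' u := rfl

@[simp] theorem star_at (a : T.BddFamilies) (u : unitSpace G) :
    (star a).at' u = star (a.at' u) := rfl

theorem norm_eq (a : T.BddFamilies) : ‖a‖ = ⨆ u, ‖a.at' u‖ := lp.norm_eq_ciSup _

theorem norm_at_le (a : T.BddFamilies) (u : unitSpace G) : ‖a.at' u‖ ≤ ‖a‖ :=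
  lp.norm_apply_le_norm ENNReal.top_ne_zero _ u

theorem norm_le {a : T.BddFamilies} {C : ℝ} (hC : 0 ≤ C) (h : ∀ u, ‖a.at' u‖ ≤ C) : ‖a‖ ≤ C :=
  lp.norm_le_of_forall_le hC h

end BddFamilies

variable (T) in
/-- `f ↦ (θ_u(f))_u`. -/
def thetaAll [EtaleGroupoid G] : T.Cc →ₗ[ℂ] T.BddFamilies where
  toFun f := ⟨fun u => f.theta u, f.memℓp_theta⟩
  map_add' f g := by
    ext u ξ : 2
    exact Subtype.ext (f.conv_add_left g ξ)
  map_smul' c f := by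
    ext u ξ : 2
    exact Subtype.ext (conv_smul_left c f ξ)

@[simp] theorem thetaAll_at [EtaleGroupoid G] (f : T.Cc) (u : unitSpace G) :
    (T.thetaAll f).at' u = f.theta u := rfl

end Twist

/-! ### The *-algebra `C_c(G;E)` -/

namespace Twist

variable {G E : Type*} [TopologicalSpace G] [ArrowGroupoid G] [TopologicalSpace E]
  [ArrowGroupoid E] {T : Twist G E}

theorem conv_eq_sum {f ξ : E → ℂ} (hf : T.Equivariant f) (hξ : T.Equivariant ξ) {e : E}
    (P : Finset G) (V : G → Set G) (hd : (P : Set G).PairwiseDisjoint V)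
    (hV : ∀ g, InjOn r (V g)) (a : G → E) (ha : ∀ g ∈ P, T.π (a g) ∈ V g)
    (har : ∀ g ∈ P, r (a g) = r e)
    (hP : ∀ k, r k = r (T.π e) → f (T.sec k) ≠ 0 → ∃ g ∈ P, k ∈ V g) :
    T.conv f ξ e = ∑ g ∈ P, f (a g) * ξ ((a g)⁻¹ * e) := by
  have hπ : ∀ g ∈ P, r (T.π (a g)) = r (T.π e) := fun g hg => by
    rw [← T.π_r, ← T.π_r, har g hg]
  let i : P → {k : G // r k = r (T.π e)} := fun g => ⟨T.π (a g), hπ g g.2⟩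
  have hi : Function.Injective i := by
    intro g h hgh
    by_contra hne
    have h1 : T.π (a g) = T.π (a h) := congrArg Subtype.val hgh
    have h2 := hd g.2 h.2 (fun e => hne (Subtype.ext e))
    exact Set.disjoint_left.1 h2 (ha g g.2) (h1 ▸ ha h h.2)
  rw [conv, ← hi.tsum_eq, tsum_fintype, ← Finset.sum_coe_sort P]
  · refine Finset.sum_congr rfl fun g _ => ?_
    exact hf.term_eq hξ (by simp [i]) (T.r_sec (hπ g g.2))
  · intro k hk
    obtain ⟨g, hg, hkg⟩ := hP k k.2 fun h => hk (by simp [h])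
    refine ⟨⟨g, hg⟩, Subtype.ext (hV g (ha g hg) hkg ?_)⟩
    rw [hπ g hg, k.2]

namespace Cc

theorem invol_mem [LCHGroupoid E] (f : T.Cc) : T.invol f ∈ T.ccSubmodule := by
  let φ : E ≃ₜ E :=
    { toFun := fun e => e⁻¹
      invFun := fun e => e⁻¹
      left_inv := inv_inv'
      right_inv := inv_inv'
      continuous_toFun := continuous_inv'
      continuous_invFun := continuous_inv' }
  refine ⟨Complex.continuous_conj.comp (f.continuous.comp continuous_inv'), ?_, fun z e => ?_⟩
  · exact (f.hasCompactSupport.comp_homeomorph φ).comp_left (map_zero _)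
  · rw [invol, T.act_inv, f.equivariant, map_mul, invol, ← Circle.coe_inv_eq_conj, inv_inv]

/-- The involution on `C_c(G;E)`. -/
instance [LCHGroupoid E] : Star T.Cc := ⟨fun f => ⟨T.invol f, f.invol_mem⟩⟩

@[simp] theorem coe_star [LCHGroupoid E] (f : T.Cc) : ⇑(star f) = T.invol f := rfl

variable [EtaleGroupoid G] [LCHGroupoid E]

theorem eventually_exists_near (f g : T.Cc) {x : G} {e₀ : E} (hx : r x = r (T.π e₀)) {V : Set G}
    (hV : IsOpen V) (hxV : x ∈ V) {ε : ℝ} (hε : 0 < ε) :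
    ∀ᶠ e in 𝓝 e₀, ∃ a, T.π a ∈ V ∧ r a = r e ∧
      dist (f a * g (a⁻¹ * e)) (f (T.sec x) * g ((T.sec x)⁻¹ * e₀)) < ε := by
  have hx0 : r (T.sec x) = r e₀ := T.r_sec hx
  have hcts : ContinuousOn (fun p : E × E => f p.1 * g (p.1⁻¹ * p.2)) {p | r p.1 = r p.2} := by
    refine (f.continuous.comp continuous_fst).continuousOn.mul ?_
    refine g.continuous.comp_continuousOn ?_
    refine (continuousOn_mul (G := E)).comp (f := fun p : E × E => (p.1⁻¹, p.2)) ?_ ?_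
    · exact ((continuous_inv'.comp continuous_fst).prodMk continuous_snd).continuousOn
    · intro p hp
      simpa using hp
  have hat := hcts (T.sec x, e₀) hx0
  have hnear : ∀ᶠ p in 𝓝 (T.sec x, e₀), p ∈ {p : E × E | r p.1 = r p.2} →
      dist (f p.1 * g (p.1⁻¹ * p.2)) (f (T.sec x) * g ((T.sec x)⁻¹ * e₀)) < ε :=
    eventually_nhdsWithin_iff.1 (Metric.tendsto_nhds.1 hat ε hε)
  rw [nhds_prod_eq, Filter.eventually_prod_iff] at hnear
  obtain ⟨pN, hN, pN', hN', hNN⟩ := hnear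
  set N : Set E := {a | pN a} with hNdef
  replace hN : N ∈ 𝓝 (T.sec x) := hN
  have hO : T.π '' N ∩ V ∈ 𝓝 x := by
    refine Filter.inter_mem ?_ (hV.mem_nhds hxV)
    have := T.isOpenMap_π.image_mem_nhds hN
    rwa [T.π_sec] at this
  have hO' : (rU : G → unitSpace G) '' (T.π '' N ∩ V) ∈ 𝓝 (rU x) :=
    (isLocalHomeomorph_r (G := G)).isOpenMap.image_mem_nhds hO
  have hrx : rU x = rU (T.π e₀) := Subtype.ext hx
  rw [hrx] at hO'
  have hcr : ContinuousAt (fun e => rU (T.π e)) e₀ :=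
    ((continuous_r.comp T.continuous_π).subtype_mk _).continuousAt
  filter_upwards [hcr.preimage_mem_nhds hO', hN'] with e he heN'
  obtain ⟨k, ⟨⟨a, haN, rfl⟩, hkV⟩, hk⟩ := he
  have hra : r a = r e := T.r_eq_of_π (congrArg Subtype.val hk)
  exact ⟨a, hkV, hra, hNN haN heN' hra⟩

theorem continuous_conv (f g : T.Cc) : Continuous (T.conv f g) := by
  classical
  rw [continuous_iff_continuousAt]
  intro e₀
  set K : Set G := T.π '' tsupport f with hK
  have hKc : IsCompact K := f.hasCompactSupport.isCompact.image T.continuous_π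
  have hKf : ∀ k, f (T.sec k) ≠ 0 → k ∈ K := fun k hk =>
    ⟨T.sec k, subset_tsupport _ hk, T.π_sec k⟩
  have hfin : {k | k ∈ K ∧ r k = r (T.π e₀)}.Finite := by
    obtain ⟨n, c, hc⟩ := TwistedGroupoid.exists_coloring hKc
    exact Set.Finite.of_injOn (f := c) (t := Set.univ) (fun _ _ => mem_univ _)
      (fun k hk l hl h => (hc k hk.1 l hl.1 h).1 (hk.2.trans hl.2.symm)) Set.finite_univ
  obtain ⟨U, hU, hUd⟩ := hfin.t2_separation
  choose W hW hWx hWi using fun x => (isLocalHomeomorph_r (G := G)).isLocallyInjective x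
  let V : G → Set G := fun x => U x ∩ W x
  have hVo : ∀ x, IsOpen (V x) := fun x => (hU x).2.inter (hW x)
  have hVx : ∀ x, x ∈ V x := fun x => ⟨(hU x).1, hWx x⟩
  have hVi : ∀ x, InjOn r (V x) := fun x a ha b hb hab => hWi x ha.2 hb.2 (Subtype.ext hab)
  set P := hfin.toFinset with hP
  have hPmem : ∀ k, k ∈ P ↔ k ∈ K ∧ r k = r (T.π e₀) := fun k => by simp [hP]
  have hVd : (P : Set G).PairwiseDisjoint V := by
    intro x hx y hy hxy
    have := hUd (by simpa [hP] using hx) (by simpa [hP] using hy) hxy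
    exact this.mono inter_subset_left inter_subset_left
  have h1 : ∀ᶠ e in 𝓝 e₀, ∀ k, r k = r (T.π e) → f (T.sec k) ≠ 0 → ∃ x ∈ P, k ∈ V x := by
    have hc : IsCompact (K \ ⋃ x ∈ P, V x) :=
      hKc.diff (isOpen_biUnion fun x _ => hVo x)
    have ho : IsOpen ((fun e => r (T.π e)) ⁻¹' (r '' (K \ ⋃ x ∈ P, V x))ᶜ) :=
      (hc.image continuous_r).isClosed.isOpen_compl.preimage
        (continuous_r.comp T.continuous_π)
    have hm : e₀ ∈ (fun e => r (T.π e)) ⁻¹' (r '' (K \ ⋃ x ∈ P, V x))ᶜ := by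
      rintro ⟨k, ⟨hkK, hkV⟩, hk⟩
      exact hkV (mem_biUnion (show k ∈ P from (hPmem k).2 ⟨hkK, hk⟩) (hVx k))
    filter_upwards [ho.mem_nhds hm] with e he k hk hfk
    by_contra hcon
    push Not at hcon
    refine he ⟨k, ⟨hKf k hfk, ?_⟩, hk⟩
    simp only [mem_iUnion, not_exists]
    exact hcon
  have h2 : ∀ x ∈ P, ∀ ε > 0, ∀ᶠ e in 𝓝 e₀, ∃ a, T.π a ∈ V x ∧ r a = r e ∧
      dist (f a * g (a⁻¹ * e)) (f (T.sec x) * g ((T.sec x)⁻¹ * e₀)) < ε := fun x hx ε hε =>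
    eventually_exists_near f g ((hPmem x).1 hx).2 (hVo x) (hVx x) hε
  rw [ContinuousAt, Metric.tendsto_nhds]
  intro ε hε
  have hδ : 0 < ε / (P.card + 1) := by positivity
  have h3 : ∀ᶠ e in 𝓝 e₀, ∀ x ∈ P, ∃ a, T.π a ∈ V x ∧ r a = r e ∧
      dist (f a * g (a⁻¹ * e)) (f (T.sec x) * g ((T.sec x)⁻¹ * e₀)) < ε / (P.card + 1) :=
    (Filter.eventually_all_finset P).2 fun x hx => h2 x hx _ hδ
  have h0 := h1.self_of_nhds
  filter_upwards [h1, h3] with e he1 he3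
  have : ∃ a : G → E, ∀ x ∈ P, T.π (a x) ∈ V x ∧ r (a x) = r e ∧
      dist (f (a x) * g ((a x)⁻¹ * e)) (f (T.sec x) * g ((T.sec x)⁻¹ * e₀)) <
        ε / (P.card + 1) := by
    choose a ha using he3
    refine ⟨fun x => if hx : x ∈ P then a x hx else e, fun x hx => ?_⟩
    simp only [dif_pos hx]
    exact ha x hx
  obtain ⟨a, ha⟩ := this
  rw [conv_eq_sum f.equivariant g.equivariant P V hVd hVi a (fun x hx => (ha x hx).1)
      (fun x hx => (ha x hx).2.1) he1,
    conv_eq_sum f.equivariant g.equivariant P V hVd hVi T.sec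
      (fun x _ => by simpa using hVx x) (fun x hx => T.r_sec ((hPmem x).1 hx).2) h0]
  refine (dist_sum_sum_le_of_le P fun x hx => (ha x hx).2.2.le).trans_lt ?_
  rw [Finset.sum_const, nsmul_eq_mul]
  have : (P.card : ℝ) * (ε / (P.card + 1)) = ε * (P.card / (P.card + 1)) := by ring
  rw [this]
  have h4 : (P.card : ℝ) / (P.card + 1) < 1 := by
    rw [div_lt_one (by positivity)]
    linarith
  nlinarith

theorem conv_mem (f g : T.Cc) : T.conv f g ∈ T.ccSubmodule := by
  refine ⟨continuous_conv f g, ?_, conv_equivariant _ g.equivariant⟩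
  have hD : IsClosed {p : E × E | s p.1 = r p.2} :=
    isClosed_eq (continuous_s.comp continuous_fst) (continuous_r.comp continuous_snd)
  have hC := (f.hasCompactSupport.isCompact.prod g.hasCompactSupport.isCompact).inter_right hD
  have hK := hC.image_of_continuousOn ((continuousOn_mul (G := E)).mono inter_subset_right)
  refine HasCompactSupport.intro hK fun e he => ?_
  have : ∀ k : {k : G // r k = r (T.π e)}, f (T.sec k) * g ((T.sec k)⁻¹ * e) = 0 := by
    intro k
    by_contra hne
    have hk := T.r_sec k.2
    refine he ⟨(T.sec k, (T.sec k)⁻¹ * e), ⟨⟨subset_tsupport _ (left_ne_zero_of_mul hne),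
      subset_tsupport _ (right_ne_zero_of_mul hne)⟩, ?_⟩, inv_mul_cancel_left' hk⟩
    change s _ = r _
    rw [r_mul _ _ (by simpa using hk), r_inv]
  simp [conv, this]

/-- The convolution product on `C_c(G;E)`. -/
instance : Mul T.Cc := ⟨fun f g => ⟨T.conv f g, f.conv_mem g⟩⟩

@[simp] theorem coe_mul (f g : T.Cc) : ⇑(f * g) = T.conv f g := rfl

end Cc

end Twist

namespace Twist

variable {G E : Type*} [TopologicalSpace G] [ArrowGroupoid G] [TopologicalSpace E]
  [ArrowGroupoid E] {T : Twist G E}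

namespace Cc

section

variable [EtaleGroupoid G]

theorem summable_conv_eq (f : T.Cc) {ξ : E → ℂ} (hξ : T.Equivariant ξ) {e : E} {u : G}
    (hu : s (T.π e) = u) :
    Summable fun h : {h : G // s h = u} => f (e * (T.sec h)⁻¹) * ξ (T.sec h) := by
  rw [← (fiberEquiv (T.π e) hu).summable_iff]
  exact (f.summable_conv ξ e).congr fun g => conv_term_eq f.equivariant hξ hu g

theorem conv_assoc (f g : T.Cc) {ξ : E → ℂ} (hξ : T.Equivariant ξ) :
    T.conv (T.conv f g) ξ = T.conv f (T.conv g ξ) := by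
  ext e
  have hfin := f.finite_row (r (T.π e))
  have hF : ∀ k : {k : G // r k = r (T.π e)}, k ∉ hfin.toFinset → f (T.sec k) = 0 := by
    intro k hk
    by_contra h
    exact hk (by simpa using h)
  have h1 : ∀ h : {h : G // s h = s (T.π e)}, T.conv f g (e * (T.sec h)⁻¹) =
      ∑ k ∈ hfin.toFinset, f (T.sec k) * g ((T.sec k)⁻¹ * e * (T.sec h)⁻¹) := by
    intro h
    have hs : s e = s (T.sec h) := (T.s_sec h.2).symm
    rw [conv_eq_of_r (v := r (T.π e)) (by rw [← T.π_r, r_mul _ _ (by simpa using hs), T.π_r]),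
      tsum_eq_sum fun k hk => by rw [hF k hk, zero_mul]]
    refine Finset.sum_congr rfl fun k _ => ?_
    rw [comp_assoc _ _ _ (by simpa using T.r_sec k.2) (by simpa using hs)]
  have h2 : ∀ k : {k : G // r k = r (T.π e)}, s (T.π ((T.sec k)⁻¹ * e)) = s (T.π e) := by
    intro k
    rw [← T.π_s, s_mul _ _ (by simpa using T.r_sec k.2), T.π_s]
  rw [conv_eq (conv_equivariant _ g.equivariant) hξ rfl, conv,
    tsum_eq_sum (s := hfin.toFinset) fun k hk => by rw [hF k hk, zero_mul]]
  simp_rw [h1, Finset.sum_mul]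
  rw [Summable.tsum_finsetSum]
  · refine Finset.sum_congr rfl fun k _ => ?_
    rw [conv_eq g.equivariant hξ (h2 k), ← tsum_mul_left]
    exact tsum_congr fun h => by ring
  · intro k _
    exact ((g.summable_conv_eq hξ (h2 k)).mul_left (f (T.sec k))).congr fun h => by ring

theorem theta_mul [LCHGroupoid E] (f g : T.Cc) (u : unitSpace G) :
    (f * g).theta u = f.theta u * g.theta u := by
  ext ξ : 1
  exact Subtype.ext (f.conv_assoc g ξ.equivariant)

end

end Cc

/-! The vector `δ_e ∈ ℓ²(G_u;E_u)` supported on `𝕋 · e` with `δ_e(e) = 1`. -/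

variable (T) in
open Classical in
/-- `δ_e(z · e) = z`, and `δ_e` vanishes off `𝕋 · e`. -/
def deltaFun (e e' : E) : ℂ :=
  if h : ∃ z : Circle, e' = T.act z e then (h.choose : Circle) else 0

theorem deltaFun_act (e : E) (z : Circle) : T.deltaFun e (T.act z e) = z := by
  have h : ∃ w : Circle, T.act z e = T.act w e := ⟨z, rfl⟩
  rw [deltaFun, dif_pos h, ← T.act_injective h.choose_spec]

theorem deltaFun_self (e : E) : T.deltaFun e e = 1 := by
  have h := T.deltaFun_act e 1
  rwa [T.one_act, Circle.coe_one] at h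

theorem deltaFun_of_ne {e e' : E} (h : T.π e' ≠ T.π e) : T.deltaFun e e' = 0 := by
  rw [deltaFun, dif_neg]
  rintro ⟨z, rfl⟩
  exact h (T.π_act z e)

theorem deltaFun_equivariant (e : E) : T.Equivariant (T.deltaFun e) := by
  intro w e'
  by_cases h : T.π e = T.π e'
  · obtain ⟨z, rfl⟩ := T.exists_act h
    rw [T.act_act, deltaFun_act, deltaFun_act, Circle.coe_mul]
  · rw [deltaFun_of_ne (Ne.symm h), deltaFun_of_ne (by simpa using Ne.symm h), mul_zero]

/-- `δ_e`, as an element of `ℓ²(G_u;E_u)` for `u = s(e)`. -/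
def delta (e : E) {u : unitSpace G} (hu : s (T.π e) = u) : T.Ell2 u :=
  ⟨T.deltaFun e, fun e' he' => deltaFun_of_ne fun h => he' (by rw [h, hu]),
    deltaFun_equivariant e, by
      classical
      refine (memℓp_zero (Set.Finite.subset (finite_singleton ⟨T.π e, hu⟩) ?_)).of_exponent_ge
        zero_le
      intro g hg
      by_contra hne
      exact hg (deltaFun_of_ne fun h => hne (Subtype.ext (by simpa using h)))⟩

@[simp] theorem delta_apply (e : E) {u : unitSpace G} (hu : s (T.π e) = u) (e' : E) :
    delta e hu e' = T.deltaFun e e' := rfl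

/-- `⟪δ_e, ξ⟫ = ξ(e)`. -/
theorem inner_delta (e : E) {u : unitSpace G} (hu : s (T.π e) = u) (ξ : T.Ell2 u) :
    inner ℂ (delta e hu) ξ = ξ e := by
  rw [Ell2.inner_eq_tsum, tsum_eq_single ⟨T.π e, hu⟩]
  · obtain ⟨z, hz⟩ := T.exists_act (e := e) (f := T.sec (T.π e)) (by simp)
    rw [delta_apply]
    simp only
    rw [hz, deltaFun_act, ξ.equivariant, ← Circle.coe_inv_eq_conj]
    have : (z : ℂ) * ((z⁻¹ : Circle) : ℂ) = 1 := by
      rw [← Circle.coe_mul]; simp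
    linear_combination ξ e * this
  · intro g hg
    rw [delta_apply, deltaFun_of_ne, map_zero, mul_zero]
    intro h
    exact hg (Subtype.ext (by simpa using h))

theorem norm_delta (e : E) {u : unitSpace G} (hu : s (T.π e) = u) :
    ‖delta e hu‖ = 1 := by
  have h := inner_self_eq_norm_sq_to_K (𝕜 := ℂ) (delta e hu)
  rw [inner_delta, delta_apply, deltaFun_self] at h
  have h2 : ‖delta e hu‖ ^ 2 = 1 := by
    have h3 : ((‖delta e hu‖ ^ 2 : ℝ) : ℂ) = 1 := by
      push_cast
      exact h.symm
    exact_mod_cast h3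
  nlinarith [norm_nonneg (delta e hu)]

/-- `(f * δ_e)(e') = f(e' e⁻¹)`. -/
theorem conv_deltaFun {f : E → ℂ} (hf : T.Equivariant f) {e e' : E} (h : s e' = s e) :
    T.conv f (T.deltaFun e) e' = f (e' * e⁻¹) := by
  have hs : s (T.π e) = s (T.π e') := by rw [← T.π_s, ← T.π_s, h]
  rw [conv_eq hf (deltaFun_equivariant e) rfl, tsum_eq_single ⟨T.π e, hs⟩]
  · obtain ⟨z, hz⟩ := T.exists_act (e := e) (f := T.sec (T.π e)) (by simp)
    simp only
    rw [hz, deltaFun_act, T.act_inv, T.mul_act _ (by simpa using h), hf]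
    have : ((z⁻¹ : Circle) : ℂ) * (z : ℂ) = 1 := by
      rw [← Circle.coe_mul]; simp
    linear_combination f (e' * e⁻¹) * this
  · intro g hg
    rw [deltaFun_of_ne, mul_zero]
    intro h
    exact hg (Subtype.ext (by simpa using h))

namespace Cc

variable [EtaleGroupoid G] [LCHGroupoid E]

theorem theta_star (f : T.Cc) (u : unitSpace G) : (star f).theta u = star (f.theta u) := by
  rw [ContinuousLinearMap.star_eq_adjoint]
  ext ξ : 1
  refine Ell2.ext fun e => ?_
  by_cases hu : s (T.π e) = u
  · rw [← inner_delta e hu, ← inner_delta e hu, ContinuousLinearMap.adjoint_inner_right,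
      inner_delta, theta_apply, conv_eq (star f).equivariant ξ.equivariant hu,
      Ell2.inner_eq_tsum]
    refine tsum_congr fun g => ?_
    have hg : s (T.sec g) = s e := T.s_sec (by rw [g.2, hu])
    have h1 : (f.theta u (delta e hu)) (T.sec g) = f (T.sec g * e⁻¹) :=
      conv_deltaFun f.equivariant hg
    rw [h1, coe_star, invol, mul_inv_rev' (by simpa using hg.symm), inv_inv', mul_comm]
  · rw [Ell2.eq_zero _ hu, Ell2.eq_zero _ hu]

end Cc

/-! ### The reduced C*-algebra -/

section Reduced

variable [EtaleGroupoid G] [LCHGroupoid E]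

theorem thetaAll_mul (f g : T.Cc) : T.thetaAll (f * g) = T.thetaAll f * T.thetaAll g := by
  ext u : 1
  exact f.theta_mul g u

theorem thetaAll_star (f : T.Cc) : T.thetaAll (star f) = star (T.thetaAll f) := by
  ext u : 1
  exact f.theta_star u

variable (T) in
/-- The closure of the image of `C_c(G;E)` in `∏_u B(ℓ²(G_u;E_u))`. -/
def reducedAlgebra : NonUnitalStarSubalgebra ℂ T.BddFamilies where
  carrier := closure (range T.thetaAll)
  add_mem' := fun ha hb => map_mem_closure₂ continuous_add ha hb (by
    rintro _ ⟨f, rfl⟩ _ ⟨g, rfl⟩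
    exact ⟨f + g, map_add _ _ _⟩)
  zero_mem' := subset_closure ⟨0, map_zero _⟩
  mul_mem' := fun ha hb => map_mem_closure₂ continuous_mul ha hb (by
    rintro _ ⟨f, rfl⟩ _ ⟨g, rfl⟩
    exact ⟨f * g, thetaAll_mul f g⟩)
  smul_mem' := fun c _ ha => map_mem_closure (continuous_const_smul c) ha (by
    rintro _ ⟨f, rfl⟩
    exact ⟨c • f, map_smul _ _ _⟩)
  star_mem' := fun ha => map_mem_closure continuous_star ha (by
    rintro _ ⟨f, rfl⟩
    exact ⟨star f, thetaAll_star f⟩)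

theorem isClosed_reducedAlgebra : IsClosed (T.reducedAlgebra : Set T.BddFamilies) :=
  isClosed_closure

variable (T) in
/-- The reduced twisted groupoid C*-algebra `C*_r(G;E)`: the completion of `C_c(G;E)` in the norm
`‖f‖_r = sup_u ‖θ_u(f)‖`, realized as the closure of the image of `C_c(G;E)` in
`∏_u B(ℓ²(G_u;E_u))`. -/
def CStarRed : Type _ := T.reducedAlgebra

namespace CStarRed

instance : NonUnitalCStarAlgebra T.CStarRed :=
  NonUnitalStarSubalgebra.nonUnitalCStarAlgebra T.reducedAlgebra
    (h_closed := T.isClosed_reducedAlgebra)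

/-- The canonical order: `0 ≤ a` if `a` is a positive element. -/
instance : PartialOrder T.CStarRed := CStarAlgebra.spectralOrder _

instance : StarOrderedRing T.CStarRed := CStarAlgebra.spectralOrderedRing _

variable (T) in
/-- The inclusion of `C*_r(G;E)` into `∏_u B(ℓ²(G_u;E_u))`. -/
def incl : T.CStarRed →⋆ₙₐ[ℂ] T.BddFamilies :=
  NonUnitalStarSubalgebraClass.subtype T.reducedAlgebra

theorem norm_incl (a : T.CStarRed) : ‖incl T a‖ = ‖a‖ := rfl

theorem incl_injective : Function.Injective (incl T) := Subtype.val_injective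

variable (T) in
/-- The inclusion `C_c(G;E) ⊆ C*_r(G;E)`. -/
def ofCc : T.Cc →ₗ[ℂ] T.CStarRed where
  toFun f := ⟨T.thetaAll f, subset_closure (mem_range_self f)⟩
  map_add' f g := Subtype.ext (map_add T.thetaAll f g)
  map_smul' c f := Subtype.ext (map_smul T.thetaAll c f)

@[simp] theorem incl_ofCc (f : T.Cc) : incl T (ofCc T f) = T.thetaAll f := rfl

theorem ofCc_mul (f g : T.Cc) : ofCc T (f * g) = ofCc T f * ofCc T g :=
  Subtype.ext (thetaAll_mul f g)

theorem ofCc_star (f : T.Cc) : ofCc T (star f) = star (ofCc T f) :=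
  Subtype.ext (thetaAll_star f)

/-- `‖f‖_r = sup_u ‖θ_u(f)‖`. -/
theorem norm_ofCc (f : T.Cc) : ‖ofCc T f‖ = ⨆ u, ‖f.theta u‖ := by
  rw [← norm_incl, incl_ofCc, BddFamilies.norm_eq]
  rfl

theorem denseRange_ofCc : DenseRange (ofCc T) := by
  intro a
  have h : incl T a ∈ closure (incl T '' range (ofCc T)) := by
    rw [← range_comp]
    exact a.2
  exact (closure_subtype (p := fun x => x ∈ T.reducedAlgebra)).2 h

end CStarRed

end Reduced

end Twist

/-! ### The map `j : C*_r(G;E) → C_0(G;E)` -/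

namespace Twist

variable {G E : Type*} [TopologicalSpace G] [ArrowGroupoid G] [TopologicalSpace E]
  [ArrowGroupoid E] {T : Twist G E}

namespace C0

instance : NormedAddCommGroup T.C0 := inferInstanceAs (NormedAddCommGroup T.c0Submodule)

instance : NormedSpace ℂ T.C0 := inferInstanceAs (NormedSpace ℂ T.c0Submodule)

instance : FunLike T.C0 E ℂ where
  coe f := f.1
  coe_injective _ _ h := Subtype.ext (DFunLike.coe_injective h)

theorem norm_le {f : T.C0} {M : ℝ} (hM : 0 ≤ M) : ‖f‖ ≤ M ↔ ∀ e, ‖f e‖ ≤ M :=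
  BoundedContinuousFunction.norm_le (f := f.1.toBCF) hM

instance : CompleteSpace T.C0 := by
  have h : IsClosed (T.c0Submodule : Set C₀(E, ℂ)) := by
    have : (T.c0Submodule : Set C₀(E, ℂ)) =
        ⋂ (z : Circle) (e : E), {f : C₀(E, ℂ) | f (T.act z e) = (z : ℂ) * f e} := by
      ext f
      simp only [mem_iInter]
      rfl
    rw [this]
    have hev : ∀ e : E, Continuous fun f : C₀(E, ℂ) => f e := fun e =>
      (continuous_eval_const (F := BoundedContinuousFunction E ℂ) e).comp
        ZeroAtInftyContinuousMap.isometry_toBCF.continuous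
    exact isClosed_iInter fun z => isClosed_iInter fun e =>
      isClosed_eq (hev _) ((hev e).const_mul _)
  exact h.completeSpace_coe

end C0

variable (T) in
/-- The inclusion `C_c(G;E) ⊆ C_0(G;E)`. -/
def ccToC0 : T.Cc →ₗ[ℂ] T.C0 where
  toFun f := ⟨⟨⟨f, f.continuous⟩, f.hasCompactSupport.is_zero_at_infty⟩, f.equivariant⟩
  map_add' _ _ := rfl
  map_smul' _ _ := rfl

@[simp] theorem ccToC0_apply (f : T.Cc) (e : E) : T.ccToC0 f e = f e := rfl

variable [EtaleGroupoid G] [LCHGroupoid E]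

theorem norm_ccToC0_le (f : T.Cc) : ‖T.ccToC0 f‖ ≤ 1 * ‖CStarRed.ofCc T f‖ := by
  rw [one_mul]
  refine (C0.norm_le (norm_nonneg _)).2 fun e => ?_
  change ‖f e‖ ≤ _
  have hu : s (T.π (s e)) = (sU (T.π e) : unitSpace G) := by simp
  have hu' : s (T.π e) = (sU (T.π e) : unitSpace G) := rfl
  have hs : (s e)⁻¹ = s e := inv_of_unit (r_s e)
  have h1 : inner ℂ (delta e hu') (f.theta _ (delta (s e) hu)) = f e := by
    rw [inner_delta]
    refine (conv_deltaFun f.equivariant (s_s e).symm).trans ?_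
    rw [hs, mul_s_self]
  calc ‖f e‖ ≤ ‖delta e hu'‖ * ‖f.theta _ (delta (s e) hu)‖ := by
        rw [← h1]; exact norm_inner_le_norm _ _
    _ ≤ ‖delta e hu'‖ * (‖f.theta (sU (T.π e))‖ * ‖delta (s e) hu‖) := by
        gcongr
        exact (f.theta _).le_opNorm _
    _ = ‖(T.thetaAll f).at' (sU (T.π e))‖ := by rw [norm_delta, norm_delta, thetaAll_at]; ring
    _ ≤ ‖T.thetaAll f‖ := BddFamilies.norm_at_le _ _

variable (T) in
/-- The map `j : C*_r(G;E) → C_0(G;E)`: the continuous extension of the inclusion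
`C_c(G;E) ⊆ C_0(G;E)`. -/
def jMap : T.CStarRed →L[ℂ] T.C0 := T.ccToC0.extendOfNorm (CStarRed.ofCc T)

@[simp] theorem jMap_ofCc (f : T.Cc) : T.jMap (CStarRed.ofCc T f) = T.ccToC0 f :=
  LinearMap.extendOfNorm_eq CStarRed.denseRange_ofCc ⟨1, norm_ccToC0_le⟩ f

theorem norm_jMap_le (a : T.CStarRed) : ‖T.jMap a‖ ≤ ‖a‖ := by
  have h := LinearMap.norm_extendOfNorm_apply_le CStarRed.denseRange_ofCc 1 norm_ccToC0_le a
  rwa [one_mul] at h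

end Twist

/-! ### Restriction to an open subgroupoid -/

namespace Twist

variable {G E : Type*} [TopologicalSpace G] [ArrowGroupoid G] [TopologicalSpace E]
  [ArrowGroupoid E] (T : Twist G E) (S : OpenSubgroupoid G)

/-- `E_S = π⁻¹(S)`. -/
def preimage : OpenSubgroupoid E where
  carrier := T.π ⁻¹' S
  isOpen' := S.isOpen.preimage T.continuous_π
  mul_mem' e he f hf hc := by
    change T.π (e * f) ∈ S
    rw [T.π_mul _ _ hc]
    exact OpenSubgroupoid.mul_mem he hf (T.π_comp hc)
  inv_mem' e he := by
    change T.π e⁻¹ ∈ S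
    rw [T.π_inv]
    exact OpenSubgroupoid.inv_mem he

theorem mem_preimage_iff {e : E} : e ∈ T.preimage S ↔ T.π e ∈ S := Iff.rfl

/-- The twist `S⁰ × 𝕋 → E_S → S`, given by restricting `ι` and `π`. -/
def restrict : Twist S (T.preimage S) where
  ι p := ⟨T.ι (S.unitIncl p.1, p.2), by
    rw [mem_preimage_iff, T.π_ι]
    exact (p.1 : S).2⟩
  π e := ⟨T.π e, e.2⟩
  r_ι u z := Subtype.ext (T.r_ι _ z)
  s_ι u z := Subtype.ext (T.s_ι _ z)
  ι_mul u z w := Subtype.ext (by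
    rw [OpenSubgroupoid.coe_mul]
    · exact T.ι_mul _ z w
    · change s (T.ι _) = r (T.ι _)
      rw [T.s_ι, T.r_ι])
  isEmbedding_ι := by
    have h1 : IsEmbedding fun p : unitSpace S × Circle => T.ι (S.unitIncl p.1, p.2) :=
      T.isEmbedding_ι.comp (S.isOpenEmbedding_unitIncl.isEmbedding.prodMap IsEmbedding.id)
    refine IsEmbedding.of_comp (g := Subtype.val) ?_ continuous_subtype_val h1
    exact h1.continuous.subtype_mk _
  π_r e := Subtype.ext (T.π_r e)
  π_s e := Subtype.ext (T.π_s e)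
  π_mul e f hc := by
    have hc' := OpenSubgroupoid.comp_coe _ hc
    apply Subtype.ext
    refine Eq.trans ?_ (OpenSubgroupoid.coe_mul S (T.π_comp hc')).symm
    exact (congrArg T.π (OpenSubgroupoid.coe_mul _ hc')).trans (T.π_mul _ _ hc')
  continuous_π := (T.continuous_π.comp continuous_subtype_val).subtype_mk _
  isOpenMap_π := T.isOpenMap_π.restrictPreimage (S : Set G)
  surjective_π g := by
    obtain ⟨e, he⟩ := T.surjective_π g
    exact ⟨⟨e, by rw [mem_preimage_iff, he]; exact g.2⟩, Subtype.ext he⟩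
  isHomeomorph_unit := by
    let φ := MapsTo.restrict T.π (unitSpace E) (unitSpace G)
      fun e he => (T.π_r e).symm.trans (congrArg T.π he)
    have hφ : IsHomeomorph φ := T.isHomeomorph_unit
    have h1 : IsOpenEmbedding (φ ∘ (T.preimage S).unitIncl) :=
      hφ.isOpenEmbedding.comp (T.preimage S).isOpenEmbedding_unitIncl
    rw [isHomeomorph_iff_isEmbedding_surjective]
    refine ⟨?_, ?_⟩
    · refine IsEmbedding.of_comp (g := S.unitIncl) ?_ S.isOpenEmbedding_unitIncl.continuous
        h1.isEmbedding
      exact ((T.continuous_π.comp (continuous_subtype_val.comp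
        continuous_subtype_val)).subtype_mk _).subtype_mk _
    · intro u
      obtain ⟨e, he⟩ := hφ.surjective (S.unitIncl u)
      have he' : T.π e = (u : S) := congrArg Subtype.val he
      have heS : (e : E) ∈ T.preimage S := by
        rw [mem_preimage_iff, he']
        exact (u : S).2
      exact ⟨⟨⟨e, heS⟩, (OpenSubgroupoid.mem_unitSpace _).2 e.2⟩,
        Subtype.ext (Subtype.ext he')⟩
  range_ι := by
    ext e
    constructor
    · rintro ⟨⟨u, z⟩, rfl⟩
      refine (OpenSubgroupoid.mem_unitSpace S).2 ?_
      change T.π (T.ι _) ∈ _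
      rw [T.π_ι]
      exact (S.unitIncl u).2
    · intro he
      have he' : (e : E) ∈ range T.ι := by
        rw [T.range_ι]
        exact (OpenSubgroupoid.mem_unitSpace S).1 he
      obtain ⟨⟨u, z⟩, hu⟩ := he'
      have huS : (u : G) ∈ S := by
        rw [← T.π_ι u z, hu]
        exact e.2
      exact ⟨(⟨⟨u, huS⟩, (OpenSubgroupoid.mem_unitSpace S).2 u.2⟩, z), Subtype.ext hu⟩
  ι_one e := Subtype.ext (T.ι_one e)
  central e z := by
    apply Subtype.ext
    rw [OpenSubgroupoid.coe_mul, OpenSubgroupoid.coe_mul]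
    · exact T.central e z
    · exact (T.r_ι_s e z).symm
    · exact T.s_ι_r e z

@[simp] theorem coe_restrict_π (e : T.preimage S) : ((T.restrict S).π e : G) = T.π e := rfl

@[simp] theorem coe_restrict_act (z : Circle) (e : T.preimage S) :
    ((T.restrict S).act z e : E) = T.act z e := by
  change (((T.restrict S).ι _ * e : T.preimage S) : E) = _
  rw [OpenSubgroupoid.coe_mul]
  · rfl
  · exact T.s_ι_r e z

variable {S}

/-- Restriction of functions, `f ↦ f|_{E_S}`, as a linear map `C_c(G;E) → C_c(S;E_S)`, for `S`
closed in `G`. -/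
def restrictCc (hS : IsClosed (S : Set G)) : T.Cc →ₗ[ℂ] (T.restrict S).Cc where
  toFun f := ⟨fun e => f e, f.continuous.comp continuous_subtype_val,
    f.hasCompactSupport.comp_isClosedEmbedding
      (IsClosed.isClosedEmbedding_subtypeVal (hS.preimage T.continuous_π)),
    fun z e => (congrArg f (T.coe_restrict_act S z e)).trans (f.equivariant z e)⟩
  map_add' _ _ := rfl
  map_smul' _ _ := rfl

@[simp] theorem restrictCc_apply (hS : IsClosed (S : Set G)) (f : T.Cc) (e : T.preimage S) :
    T.restrictCc hS f e = f e := rfl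

/-- Extension of functions by zero. -/
def extFun (f : T.preimage S → ℂ) : E → ℂ := Function.extend Subtype.val f 0

@[simp] theorem extFun_coe (f : T.preimage S → ℂ) (e : T.preimage S) : T.extFun f e = f e :=
  Subtype.val_injective.extend_apply _ _ _

theorem extFun_of_notMem (f : T.preimage S → ℂ) {e : E} (he : e ∉ T.preimage S) :
    T.extFun f e = 0 :=
  Function.extend_apply' _ _ _ (by rintro ⟨e', rfl⟩; exact he e'.2)

theorem extFun_equivariant {f : T.preimage S → ℂ} (hf : (T.restrict S).Equivariant f) :
    T.Equivariant (T.extFun f) := by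
  intro z e
  by_cases he : e ∈ T.preimage S
  · have h1 := hf z ⟨e, he⟩
    rw [← T.extFun_coe f, ← T.extFun_coe f, coe_restrict_act] at h1
    exact h1
  · rw [T.extFun_of_notMem f he, T.extFun_of_notMem, mul_zero]
    rwa [mem_preimage_iff, T.π_act]

variable (S) in
/-- Extension by zero, as a linear map `C_c(S;E_S) → C_c(G;E)`. -/
def extendCc [LCHGroupoid E] : (T.restrict S).Cc →ₗ[ℂ] T.Cc where
  toFun f := ⟨T.extFun f,
    HasCompactSupport.continuous_extend_zero (U := (T.preimage S : Set E)) (T.preimage S).isOpen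
      f.continuous f.hasCompactSupport,
    f.hasCompactSupport.extend_zero continuous_subtype_val, T.extFun_equivariant f.equivariant⟩
  map_add' f g := by
    ext e
    by_cases he : e ∈ T.preimage S
    · exact (T.extFun_coe _ ⟨e, he⟩).trans
        (congrArg₂ (· + ·) (T.extFun_coe f ⟨e, he⟩) (T.extFun_coe g ⟨e, he⟩)).symm
    · refine (T.extFun_of_notMem _ he).trans ?_
      refine Eq.trans ?_ (congrArg₂ (· + ·) (T.extFun_of_notMem f he)
        (T.extFun_of_notMem g he)).symm
      simp
  map_smul' c f := by
    ext e
    by_cases he : e ∈ T.preimage S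
    · exact (T.extFun_coe _ ⟨e, he⟩).trans (congrArg (c * ·) (T.extFun_coe f ⟨e, he⟩)).symm
    · refine (T.extFun_of_notMem _ he).trans ?_
      refine Eq.trans ?_ (congrArg (c * ·) (T.extFun_of_notMem f he)).symm
      simp

@[simp] theorem coe_extendCc [LCHGroupoid E] (f : (T.restrict S).Cc) :
    ⇑(T.extendCc S f) = T.extFun f := rfl

end Twist

/-! ### The inclusion `i : C*_r(S;E_S) → C*_r(G;E)` -/

namespace Twist

variable {G E : Type*} [TopologicalSpace G] [ArrowGroupoid G] [TopologicalSpace E]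
  [ArrowGroupoid E] (T : Twist G E) {S : OpenSubgroupoid G}

/-- The function `σ ↦ ξ(σ e)` on `{σ ∈ E_S | s(σ) = r(e)}`, extended by zero to `E_S`. -/
def translateFun (ξ : E → ℂ) (e : E) (σ : T.preimage S) : ℂ :=
  open Classical in if s (σ : E) = r e then ξ (σ * e) else 0

variable {T}

theorem translateFun_equivariant {ξ : E → ℂ} (hξ : T.Equivariant ξ) (e : E) :
    (T.restrict S).Equivariant (T.translateFun ξ e) := by
  intro z σ
  by_cases h : s (σ : E) = r e
  · rw [translateFun, translateFun, if_pos h, if_pos (by rw [coe_restrict_act, T.s_act, h]),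
      coe_restrict_act, T.act_mul _ h, hξ]
  · rw [translateFun, translateFun, if_neg h, if_neg (by rwa [coe_restrict_act, T.s_act]),
      mul_zero]

/-- The elements of `G_{s(k)}` in the coset `S k`. -/
def cosetEquiv (k : G) {u : G} (hu : s k = u) {v : S} (hv : (v : G) = r k) :
    {h : S // s h = v} ≃ {x : G // s x = u ∧ x * k⁻¹ ∈ S} where
  toFun h :=
    have hc : s ((h : S) : G) = r k := (congrArg Subtype.val h.2).trans hv
    ⟨(h : S) * k, by rw [s_mul _ _ hc, hu], by
      rw [mul_inv_cancel_right' hc]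
      exact (h : S).2⟩
  invFun x := ⟨⟨(x : G) * k⁻¹, x.2.2⟩, Subtype.ext (by
    change s ((x : G) * k⁻¹) = v
    rw [s_mul _ _ (by simp [x.2.1, hu]), s_inv, hv])⟩
  left_inv h := Subtype.ext (Subtype.ext (mul_inv_cancel_right'
    ((congrArg Subtype.val h.2).trans hv)))
  right_inv x := Subtype.ext (inv_mul_cancel_right' (by rw [x.2.1, hu]))

theorem conv_extFun {f : T.preimage S → ℂ} (hf : (T.restrict S).Equivariant f) {ξ : E → ℂ}
    (hξ : T.Equivariant ξ) {e : E} (σ : T.preimage S) (h : s (σ : E) = r e) :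
    T.conv (T.extFun f) ξ (σ * e) = (T.restrict S).conv f (T.translateFun ξ e) σ := by
  have hr : r (T.π (σ * e)) = r (T.π σ) := by rw [← T.π_r, ← T.π_r, r_mul _ _ h]
  let j : {g : S // r g = r ((T.restrict S).π σ)} → {g : G // r g = r (T.π (σ * e))} :=
    fun g => ⟨(g : S), (congrArg Subtype.val g.2).trans hr.symm⟩
  have hj : Function.Injective j := fun g g' hgg => by
    have h1 : ((j g : G)) = j g' := congrArg Subtype.val hgg
    exact Subtype.ext (Subtype.ext h1)
  rw [conv, ← hj.tsum_eq, conv]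
  · refine tsum_congr fun g => ?_
    set a := (T.restrict S).sec (g : S) with ha
    have hra : r a = r σ := (T.restrict S).r_sec g.2
    have hra' : r (a : E) = r (σ : E) := congrArg Subtype.val hra
    have hπ : T.π (T.sec (j g : G)) = T.π a := by
      rw [T.π_sec, ← coe_restrict_π, ha, π_sec]
    rw [(T.extFun_equivariant hf).term_eq hξ hπ (T.r_sec (j g).2), extFun_coe]
    congr 1
    have hcoe : ((a⁻¹ * σ : T.preimage S) : E) = (a : E)⁻¹ * σ :=
      OpenSubgroupoid.coe_mul _ (by simpa using hra')
    have hs : s ((a : E)⁻¹ * σ) = r e := by rw [s_mul _ _ (by simpa using hra'), h]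
    rw [translateFun, if_pos (by rw [hcoe, hs]), hcoe, comp_assoc _ _ _ (by simpa using hra') h]
  · intro g hg
    have hgS : (g : G) ∈ S := by
      by_contra hne
      exact hg (by simp only [T.extFun_of_notMem f (e := T.sec g) (by
        rwa [mem_preimage_iff, T.π_sec]), zero_mul])
    exact ⟨⟨⟨g, hgS⟩, Subtype.ext (g.2.trans hr)⟩, rfl⟩

theorem tsum_coset {ξ : E → ℂ} (hξ : T.Equivariant ξ) (k : G) {u : G} (hu : s k = u)
    {v : S} (hv : (v : G) = r k) :
    ∑' h : {h : S // s h = v}, ‖T.translateFun ξ (T.sec k) ((T.restrict S).sec h)‖ₑ ^ 2 =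
      ∑' x : {x : G // s x = u ∧ x * k⁻¹ ∈ S}, ‖ξ (T.sec x)‖ₑ ^ 2 := by
  rw [← (cosetEquiv k hu hv).tsum_eq]
  refine tsum_congr fun h => ?_
  have hh : s ((h : S) : G) = r k := (congrArg Subtype.val h.2).trans hv
  have hs : s ((T.restrict S).sec h : E) = r (T.sec k) := by
    refine T.comp_of_π ?_
    rw [← coe_restrict_π, π_sec, π_sec, hh]
  rw [translateFun, if_pos hs, ← ofReal_norm, ← ofReal_norm, hξ.norm_eq]
  rw [T.π_mul _ _ hs, ← coe_restrict_π, π_sec, π_sec, π_sec]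
  rfl

theorem extendCc_star [LCHGroupoid E] (f : (T.restrict S).Cc) :
    T.extendCc S (star f) = star (T.extendCc S f) := by
  ext e
  rw [Cc.coe_star, coe_extendCc, coe_extendCc, invol]
  by_cases he : e ∈ T.preimage S
  · refine (T.extFun_coe _ ⟨e, he⟩).trans ?_
    rw [Cc.coe_star, invol]
    congr 1
    exact (T.extFun_coe f (⟨e, he⟩ : T.preimage S)⁻¹).symm
  · rw [T.extFun_of_notMem _ he, T.extFun_of_notMem, map_zero]
    intro h
    exact he (by simpa using OpenSubgroupoid.inv_mem h)

variable [EtaleGroupoid G] [LCHGroupoid E]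

theorem coset_le (f : (T.restrict S).Cc) {u : unitSpace G} (ξ : T.Ell2 u) {k : G}
    (hu : s k = u) (hk : r k ∈ S) :
    ∑' x : {x : G // s x = u ∧ x * k⁻¹ ∈ S}, ‖T.conv (T.extFun f) ξ (T.sec x)‖ₑ ^ 2 ≤
      ‖CStarRed.ofCc (T.restrict S) f‖ₑ ^ 2 *
        ∑' x : {x : G // s x = u ∧ x * k⁻¹ ∈ S}, ‖ξ (T.sec x)‖ₑ ^ 2 := by
  let v : unitSpace S := ⟨⟨r k, hk⟩, (OpenSubgroupoid.mem_unitSpace S).2 (r_r k)⟩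
  have hv : ((v : S) : G) = r k := rfl
  have hX := tsum_coset (T := T) (S := S) ξ.equivariant k hu hv
  have hlt : ∑' x : {x : G // s x = u ∧ x * k⁻¹ ∈ S}, ‖ξ (T.sec x)‖ₑ ^ 2 < ⊤ := by
    have h1 : ∑' g : {g : G // s g = u}, ‖ξ (T.sec g)‖ₑ ^ 2 < ⊤ := by
      rw [← Ell2.enorm_sq]
      exact ENNReal.pow_lt_top enorm_lt_top
    refine lt_of_le_of_lt ?_ h1
    exact ENNReal.tsum_comp_le_tsum_of_injective
      (f := fun x : {x : G // s x = u ∧ x * k⁻¹ ∈ S} => (⟨x, x.2.1⟩ : {g : G // s g = u}))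
      (fun x y h => by
        have h1 := congrArg Subtype.val h
        exact Subtype.ext h1) _
  let η : (T.restrict S).Ell2 v := ⟨T.translateFun ξ (T.sec k), fun σ hσ => by
      rw [translateFun, if_neg]
      intro h
      refine hσ (Subtype.ext ?_)
      change s (T.π σ) = r k
      rw [T.π_comp h, T.π_sec],
    translateFun_equivariant ξ.equivariant _, by
      rw [← hX] at hlt
      refine memℓp_gen ?_
      simpa using ENNReal.summable_toReal hlt.ne⟩
  have hη : ‖η‖ₑ ^ 2 = ∑' x : {x : G // s x = u ∧ x * k⁻¹ ∈ S}, ‖ξ (T.sec x)‖ₑ ^ 2 := by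
    rw [Ell2.enorm_sq, ← hX]
  have hθ : ‖f.theta v η‖ₑ ^ 2 = ∑' x : {x : G // s x = u ∧ x * k⁻¹ ∈ S},
      ‖T.conv (T.extFun f) ξ (T.sec x)‖ₑ ^ 2 := by
    rw [Ell2.enorm_sq, ← (cosetEquiv k hu hv).tsum_eq]
    refine tsum_congr fun h => ?_
    have hs : s ((T.restrict S).sec h : E) = r (T.sec k) := by
      refine T.comp_of_π ?_
      rw [← coe_restrict_π, π_sec, π_sec]
      exact (congrArg Subtype.val h.2).trans hv
    have h1 : f.theta v η ((T.restrict S).sec h) =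
        T.conv (T.extFun f) ξ ((T.restrict S).sec h * T.sec k) :=
      (conv_extFun f.equivariant ξ.equivariant _ hs).symm
    rw [h1, ← ofReal_norm, ← ofReal_norm, (conv_equivariant _ ξ.equivariant).norm_eq]
    rw [T.π_mul _ _ hs, ← coe_restrict_π, π_sec, π_sec, π_sec]
    rfl
  rw [← hη, ← hθ, ← mul_pow]
  gcongr
  have h2 : ‖f.theta v η‖ ≤ ‖CStarRed.ofCc (T.restrict S) f‖ * ‖η‖ :=
    ((f.theta v).le_opNorm η).trans (mul_le_mul_of_nonneg_right
      (BddFamilies.norm_at_le ((T.restrict S).thetaAll f) v) (norm_nonneg _))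
  rw [enorm_eq_nnnorm, enorm_eq_nnnorm, enorm_eq_nnnorm]
  exact_mod_cast h2

theorem norm_extendCc_le (f : (T.restrict S).Cc) :
    ‖CStarRed.ofCc T (T.extendCc S f)‖ ≤ 1 * ‖CStarRed.ofCc (T.restrict S) f‖ := by
  classical
  rw [one_mul]
  refine BddFamilies.norm_le (a := T.thetaAll (T.extendCc S f)) (norm_nonneg _) fun u => ?_
  refine ContinuousLinearMap.opNorm_le_bound _ (norm_nonneg _) fun ξ => ?_
  let J : Type _ := {x : {x : G // s x = u} // r (x : G) ∈ S}
  let rel : Setoid J :=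
    { r := fun x y => (x.1 : G) * (y.1 : G)⁻¹ ∈ S
      iseqv :=
        { refl := fun x => by rw [mul_inv_eq]; exact x.2
          symm := fun {x y} h => by
            have := OpenSubgroupoid.inv_mem h
            rwa [mul_inv_rev' (by simp [x.1.2, y.1.2]), inv_inv'] at this
          trans := fun {x y z} h h' => by
            have h1 := OpenSubgroupoid.mul_mem h h' (by
              rw [s_mul _ _ (by simp [x.1.2, y.1.2]), r_mul _ _ (by simp [y.1.2, z.1.2]), s_inv])
            rwa [← comp_assoc _ _ _ (by
                rw [s_mul _ _ (by simp [x.1.2, y.1.2]), s_inv]) (by simp [y.1.2, z.1.2]),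
              inv_mul_cancel_right' (by simp [x.1.2, y.1.2])] at h1 } }
  have hsplit : ∀ F : G → ℝ≥0∞, ∑' x : J, F x.1 = ∑' q : Quotient rel,
      ∑' x : {x : G // s x = u ∧ x * (q.out.1 : G)⁻¹ ∈ S}, F x := by
    intro F
    rw [← (Equiv.sigmaFiberEquiv (Quotient.mk rel)).tsum_eq, ENNReal.tsum_sigma']
    refine tsum_congr fun q => ?_
    let e : {x : J // Quotient.mk rel x = q} ≃
        {x : G // s x = u ∧ x * (q.out.1 : G)⁻¹ ∈ S} :=
      { toFun := fun x => ⟨x.1.1, x.1.1.2, by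
          have h1 : Quotient.mk rel x.1 = Quotient.mk rel q.out := by rw [x.2, Quotient.out_eq]
          exact Quotient.exact h1⟩
        invFun := fun x => ⟨⟨⟨x, x.2.1⟩, by
          have h1 := OpenSubgroupoid.r_mem x.2.2
          rwa [r_mul _ _ (by simp [x.2.1, q.out.1.2])] at h1⟩, by
          exact (Quotient.sound x.2.2).trans (Quotient.out_eq q)⟩
        left_inv := fun x => rfl
        right_inv := fun x => rfl }
    rw [← e.tsum_eq]
    rfl
  have h1 : ‖(T.extendCc S f).theta u ξ‖ₑ ^ 2 =
      ∑' x : J, ‖T.conv (T.extFun f) ξ (T.sec x.1)‖ₑ ^ 2 := by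
    rw [Ell2.enorm_sq]
    have hinj : Function.Injective fun x : J => x.1 := Subtype.val_injective
    rw [← hinj.tsum_eq]
    · rfl
    · intro x hx
      by_cases hxS : r (x : G) ∈ S
      · exact ⟨⟨x, hxS⟩, rfl⟩
      · exfalso
        refine hx ?_
        have h2 : ∀ g : {g : G // r g = r (T.π (T.sec x))},
            T.extFun f (T.sec g) * ξ ((T.sec g)⁻¹ * T.sec x) = 0 := by
          intro g
          rw [T.extFun_of_notMem f, zero_mul]
          rw [mem_preimage_iff, T.π_sec]
          intro hg
          refine hxS ?_
          have h3 := OpenSubgroupoid.r_mem hg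
          rwa [g.2, T.π_sec] at h3
        have h4 : (T.extendCc S f).theta u ξ (T.sec x) = 0 := by
          rw [Cc.theta_apply, conv]
          simp only [coe_extendCc, h2, tsum_zero]
        simp only [h4]
        simp
  have h2 : ∑' x : J, ‖ξ (T.sec x.1)‖ₑ ^ 2 ≤ ‖ξ‖ₑ ^ 2 := by
    rw [Ell2.enorm_sq]
    exact ENNReal.tsum_comp_le_tsum_of_injective (f := fun x : J => x.1)
      Subtype.val_injective _
  have h3 : ‖(T.extendCc S f).theta u ξ‖ₑ ^ 2 ≤
      (‖CStarRed.ofCc (T.restrict S) f‖ₑ * ‖ξ‖ₑ) ^ 2 := by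
    rw [h1, hsplit fun x => ‖T.conv (T.extFun f) ξ (T.sec x)‖ₑ ^ 2]
    refine (ENNReal.tsum_le_tsum fun q => coset_le f ξ q.out.1.2 q.out.2).trans ?_
    rw [ENNReal.tsum_mul_left, ← hsplit fun x => ‖ξ (T.sec x)‖ₑ ^ 2, mul_pow]
    gcongr
  rw [ENNReal.pow_le_pow_left_iff two_ne_zero, enorm_eq_nnnorm, enorm_eq_nnnorm,
    enorm_eq_nnnorm] at h3
  exact_mod_cast h3

theorem extendCc_mul (f g : (T.restrict S).Cc) :
    T.extendCc S (f * g) = T.extendCc S f * T.extendCc S g := by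
  ext e
  rw [Cc.coe_mul, coe_extendCc, coe_extendCc, coe_extendCc]
  by_cases he : e ∈ T.preimage S
  · let σ : T.preimage S := ⟨e, he⟩
    have h1 := conv_extFun f.equivariant (T.extFun_equivariant g.equivariant) (e := s e) σ
      (r_s e).symm
    have h2 : (σ : E) * s e = e := mul_s_self e
    rw [h2] at h1
    rw [h1]
    refine (T.extFun_coe _ σ).trans ?_
    rw [Cc.coe_mul, conv, conv]
    refine tsum_congr fun k => ?_
    congr 1
    set a := (T.restrict S).sec (k : S) with ha
    have hra : r (a : E) = r (σ : E) := congrArg Subtype.val ((T.restrict S).r_sec k.2)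
    have hcoe : ((a⁻¹ * σ : T.preimage S) : E) = (a : E)⁻¹ * σ :=
      OpenSubgroupoid.coe_mul _ (by simpa using hra)
    have hs : s ((a⁻¹ * σ : T.preimage S) : E) = s e := by
      rw [hcoe, s_mul _ _ (by simpa using hra)]
    rw [translateFun, if_pos (by rw [hs, r_s]), ← hs, mul_s_self, extFun_coe]
  · rw [T.extFun_of_notMem _ he, conv]
    have h2 : ∀ k : {k : G // r k = r (T.π e)},
        T.extFun f (T.sec k) * T.extFun g ((T.sec k)⁻¹ * e) = 0 := by
      intro k
      by_contra hne
      have hk : T.sec k ∈ T.preimage S := by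
        by_contra hn
        exact hne (by rw [T.extFun_of_notMem f hn, zero_mul])
      have hk' : (T.sec k)⁻¹ * e ∈ T.preimage S := by
        by_contra hn
        exact hne (by rw [T.extFun_of_notMem g hn, mul_zero])
      have hr := T.r_sec k.2
      refine he ?_
      rw [← inv_mul_cancel_left' hr]
      exact OpenSubgroupoid.mul_mem hk hk' (by rw [r_mul _ _ (by simpa using hr), r_inv])
    simp [h2]

variable (T S) in
/-- The continuous linear extension of extension by zero `C_c(S;E_S) → C_c(G;E)`. -/
def iLin : (T.restrict S).CStarRed →L[ℂ] T.CStarRed :=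
  (CStarRed.ofCc T ∘ₗ T.extendCc S).extendOfNorm (CStarRed.ofCc (T.restrict S))

theorem iLin_ofCc (f : (T.restrict S).Cc) :
    T.iLin S (CStarRed.ofCc _ f) = CStarRed.ofCc T (T.extendCc S f) :=
  LinearMap.extendOfNorm_eq (f := CStarRed.ofCc T ∘ₗ T.extendCc S) CStarRed.denseRange_ofCc
    ⟨1, norm_extendCc_le⟩ f

variable (T S) in
/-- The inclusion `i : C*_r(S;E_S) → C*_r(G;E)`: the continuous extension of extension by zero
`C_c(S;E_S) → C_c(G;E)`, which is a *-homomorphism. -/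
def iMap : (T.restrict S).CStarRed →⋆ₙₐ[ℂ] T.CStarRed where
  toFun := T.iLin S
  map_smul' c a := map_smul (T.iLin S) c a
  map_zero' := map_zero (T.iLin S)
  map_add' := map_add (T.iLin S)
  map_mul' a b := by
    refine CStarRed.denseRange_ofCc.induction_on₂ (p := fun a b =>
      T.iLin S (a * b) = T.iLin S a * T.iLin S b)
      (isClosed_eq (by fun_prop) (by fun_prop)) (fun f g => ?_) a b
    rw [← CStarRed.ofCc_mul, iLin_ofCc, iLin_ofCc, iLin_ofCc, extendCc_mul, CStarRed.ofCc_mul]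
  map_star' a := by
    refine CStarRed.denseRange_ofCc.induction_on (p := fun a =>
      T.iLin S (star a) = star (T.iLin S a)) a
      (isClosed_eq (by fun_prop) (by fun_prop)) (fun f => ?_)
    rw [← CStarRed.ofCc_star, iLin_ofCc, iLin_ofCc, extendCc_star, CStarRed.ofCc_star]

theorem iMap_ofCc (f : (T.restrict S).Cc) :
    T.iMap S (CStarRed.ofCc _ f) = CStarRed.ofCc T (T.extendCc S f) := iLin_ofCc f

end Twist

/-! ### Conditional expectations -/

/-- `P` is a conditional expectation from the C*-algebra `A` onto the C*-subalgebra `B`: a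
contractive completely positive (in particular linear) map `P : A → A` with values in `B` and
`P b = b` for all `b ∈ B`, such that `P (b * a) = b * P a` and `P (a * b) = P a * b` for all
`a ∈ A` and `b ∈ B`. -/
structure IsConditionalExpectation {A : Type*} [NonUnitalCStarAlgebra A] [PartialOrder A]
    [StarOrderedRing A] (B : NonUnitalStarSubalgebra ℂ A) (P : A → A) : Prop where
  completelyPositive : ∃ Q : CompletelyPositiveMap A A, ∀ a, Q.toLinearMap a = P a
  contractive : ∀ a, ‖P a‖ ≤ ‖a‖
  map_mem : ∀ a, P a ∈ B
  map_of_mem : ∀ b ∈ B, P b = b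
  map_mul_left : ∀ b ∈ B, ∀ a, P (b * a) = b * P a
  map_mul_right : ∀ b ∈ B, ∀ a, P (a * b) = P a * b

/-- `P` is faithful: `P (a* a) = 0` implies `a = 0`. -/
def IsFaithful {A : Type*} [NonUnitalCStarAlgebra A] (P : A → A) : Prop :=
  ∀ a, P (star a * a) = 0 → a = 0

end TwistedGroupoid

end

/-! Everything rests on one formula. For `v` in the unit space of `S`, extension by zero is an
isometry `W` from `ℓ²(S_v;E_{S,v})` to `ℓ²(G_v;E_v)`, and `W* θ_v(f) W = θ_v(f|_{E_S})` for `f` in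
`C_c(G;E)` (`compress_theta`). Indeed, if `e` and `σ(g)⁻¹ e` lie in `E_S`, then so does `σ(g)`;
hence only arrows of `S` contribute to `(f * Wξ)(e)` (`conv_extFun_right`). Closedness of `S` enters
in that `f|_{E_S}` again has compact support.

Compression by an isometry does not increase norms, so restriction is contractive for the reduced
norms and extends to `Φ` (here `restrictRed`). By density and continuity the formula survives for
all elements (`rep_restrictRed`), and so do the algebraic identities visible on functions: `Φ`
commutes with the involution, `Φ ∘ i = id`, `Φ(i(b) a) = b Φ(a)`, and `j_S ∘ Φ` is `j_G` followed by
restriction. Adjoints give the right-hand module property.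

Complete positivity: the quadratic form of `Φ(N* N)`, taken entrywise on matrices, at vectors `η_i`
is `∑_l ‖∑_j N_{lj} W η_j‖² ≥ 0`. That nonnegativity in all regular representations implies
positivity in the matrix algebra is `cstarMatrix_nonneg`: if `N` now denotes the negative part of a
selfadjoint `M`, then `-N M N = N³`, and evaluating the form of `M` on columns of `N` forces `N =
0`. Finally `i`, as a *-homomorphism, is itself completely positive.

Faithfulness: if `Φ(a* a) = 0` and the unit spaces agree, the formula at `δ_e`, with `e` a unit,
gives `‖a δ_e‖² = 0`. The coefficient of `a δ_e` at `e'` is `j(a)(e' e⁻¹)` (`rep_delta`), so the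
vectors `a δ_e` at units already determine `j(a)`, and `j(a)` determines all matrix coefficients of
`a`. Hence `a = 0` (`eq_zero_of_rep_delta`). -/

noncomputable section

namespace TwistedGroupoid

open ArrowGroupoid LCHGroupoid EtaleGroupoid

/-! ### Detecting positivity through the negative part -/

/-- For selfadjoint `a` with negative part `N`, the element `-(N * a * N) = N³` is of the form
`q* q`, and it only vanishes if `a` is positive. -/
theorem exists_star_mul_self_eq_neg_conjugate {A : Type*} [NonUnitalCStarAlgebra A]
    [PartialOrder A] [StarOrderedRing A] {a : A} (ha : IsSelfAdjoint a) :
    ∃ N q, star N = N ∧ star q * q = -(N * a * N) ∧ (q = 0 → 0 ≤ a) := by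
  have hN : 0 ≤ a⁻ := CFC.negPart_nonneg a
  have hs : star a⁻ = a⁻ := hN.isSelfAdjoint
  have h1 : -(a⁻ * a * a⁻) = a⁻ * a⁻ * a⁻ := by
    -- The positive and negative parts are orthogonal, so multiplying `a` by its negative part
    -- leaves only the latter, with a sign.
    have h0 : a⁻ * a = a⁻ * (a⁺ - a⁻) := by rw [CFC.posPart_sub_negPart a]
    rw [h0, mul_sub, CFC.negPart_mul_posPart, zero_sub, neg_mul, neg_neg]
  obtain ⟨q, hq⟩ := CStarAlgebra.nonneg_iff_eq_star_mul_self.1 (conjugate_nonneg_of_nonneg hN hN)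
  refine ⟨a⁻, q, hs, by rw [h1, hq], ?_⟩
  rintro rfl
  rw [mul_zero] at hq
  -- From `N³ = 0` one gets `N⁴ = 0`; since `N` is selfadjoint, the C*-identity applied twice then
  -- gives `N² = 0` and `N = 0`.
  have h2 : star (a⁻ * a⁻) * (a⁻ * a⁻) = 0 := by
    rw [star_mul, hs, ← mul_assoc, hq, zero_mul]
  have h3 : star a⁻ * a⁻ = 0 := by
    rw [hs]; exact CStarRing.star_mul_self_eq_zero_iff _ |>.1 h2
  exact CStarAlgebra.nonneg_iff_isSelfAdjoint_and_negPart_eq_zero.2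
    ⟨ha, (CStarRing.star_mul_self_eq_zero_iff _).1 h3⟩

theorem exists_eq_star_mul_self {A : Type*} [NonUnitalCStarAlgebra A] [PartialOrder A]
    [StarOrderedRing A] {a : A} (ha : 0 ≤ a) : ∃ b, a = star b * b :=
  CStarAlgebra.nonneg_iff_eq_star_mul_self.1 ha

/-! ### Positivity and matrix coefficients in the regular representations -/

namespace Twist

variable {G E : Type*} [TopologicalSpace G] [ArrowGroupoid G] [EtaleGroupoid G]
  [TopologicalSpace E] [ArrowGroupoid E] [LCHGroupoid E] {T : Twist G E}

theorem continuous_jMap_apply (e : E) : Continuous fun a : T.CStarRed => T.jMap a e :=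
  ((continuous_eval_const (F := BoundedContinuousFunction E ℂ) e).comp
    (ZeroAtInftyContinuousMap.isometry_toBCF.continuous.comp continuous_subtype_val)).comp
    (T.jMap).continuous

namespace CStarRed

variable (T) in
/-- The regular representation of `C*_r(G;E)` on `ℓ²(G_u;E_u)`, extending `θ_u`. -/
def rep (u : unitSpace G) : T.CStarRed →⋆ₙₐ[ℂ] (T.Ell2 u →L[ℂ] T.Ell2 u) where
  toFun a := (incl T a).at' u
  map_smul' _ _ := rfl
  map_zero' := rfl
  map_add' _ _ := rfl
  map_mul' _ _ := rfl
  map_star' _ := rfl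

@[simp] theorem rep_ofCc (u : unitSpace G) (f : T.Cc) : rep T u (ofCc T f) = f.theta u := rfl

theorem rep_ext {a b : T.CStarRed} (h : ∀ u, rep T u a = rep T u b) : a = b :=
  incl_injective (BddFamilies.ext h)

theorem norm_rep_le (u : unitSpace G) (a : T.CStarRed) : ‖rep T u a‖ ≤ ‖a‖ :=
  BddFamilies.norm_at_le (incl T a) u

theorem norm_le {a : T.CStarRed} {C : ℝ} (hC : 0 ≤ C) (h : ∀ u, ‖rep T u a‖ ≤ C) : ‖a‖ ≤ C :=
  BddFamilies.norm_le (a := incl T a) hC h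

@[fun_prop] theorem continuous_rep (u : unitSpace G) : Continuous (rep T u) :=
  map_continuous (rep T u)

theorem inner_rep_star_mul (u : unitSpace G) (a b : T.CStarRed) (ξ η : T.Ell2 u) :
    inner ℂ ξ (rep T u (star a * b) η) = inner ℂ (rep T u a ξ) (rep T u b η) := by
  rw [map_mul, map_star, ContinuousLinearMap.star_eq_adjoint, mul_apply_eq_comp,
    ContinuousLinearMap.adjoint_inner_right]

/-- A selfadjoint matrix over `C*_r(G;E)` is positive if it is so in all regular
representations. -/
theorem cstarMatrix_nonneg {k : ℕ} {M : CStarMatrix (Fin k) (Fin k) T.CStarRed}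
    (hM : IsSelfAdjoint M) (h : ∀ (u : unitSpace G) (η : Fin k → T.Ell2 u),
      0 ≤ (∑ i, ∑ j, inner ℂ (η i) (rep T u (M i j) (η j))).re) : 0 ≤ M := by
  obtain ⟨N, q, hN, hq, h0⟩ := exists_star_mul_self_eq_neg_conjugate hM
  -- It suffices to show `q = 0`, and this may be tested entry by entry on each vector `ξ` of each
  -- regular representation.
  refine h0 (CStarMatrix.ext fun l j => rep_ext fun u => ?_)
  ext ξ : 1
  have h1 : ∑ l, star (q l j) * q l j = -∑ i, star (N i j) * ∑ l, M i l * N l j := by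
    have h2 := congrFun (congrFun hq j) j
    rw [mul_assoc] at h2
    -- Selfadjointness of `N` makes the entry of the left factor at `(j, i)` the adjoint of the
    -- entry at `(i, j)`, so that the right-hand side becomes a quadratic form in column `j` of `N`.
    conv_rhs at h2 => rw [← hN]
    rw [CStarMatrix.neg_apply, CStarMatrix.mul_apply, CStarMatrix.mul_apply] at h2
    simpa only [CStarMatrix.star_apply, CStarMatrix.mul_apply, hN] using h2
  have h3 : (∑ l, inner ℂ (rep T u (q l j) ξ) (rep T u (q l j) ξ)) =
      -∑ i, ∑ l, inner ℂ (rep T u (N i j) ξ) (rep T u (M i l) (rep T u (N l j) ξ)) := by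
    have h4 := congrArg (fun x => inner ℂ ξ (rep T u x ξ)) h1
    simp only [map_sum, map_neg, sum_apply, neg_apply, inner_sum, inner_neg_right,
      inner_rep_star_mul] at h4
    simpa only [map_mul, mul_apply_eq_comp] using h4
  have h5 := congrArg Complex.re h3
  rw [Complex.neg_re, Complex.re_sum] at h5
  -- Testing the hypothesis on column `j` of `N` applied to `ξ` shows that the sum of the squares
  -- `‖q_{lj} ξ‖²` over `l` is at most `0`; hence every summand vanishes.
  have h6 := h u fun i => rep T u (N i j) ξ
  have h7 : ∀ l ∈ Finset.univ, 0 ≤ (inner ℂ (rep T u (q l j) ξ) (rep T u (q l j) ξ)).re :=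
    fun l _ => inner_self_nonneg (𝕜 := ℂ)
  have h8 := (Finset.sum_eq_zero_iff_of_nonneg h7).1
    (le_antisymm (by rw [h5]; linarith) (Finset.sum_nonneg h7)) l (Finset.mem_univ l)
  have h9 : rep T u (q l j) ξ = 0 := re_inner_self_nonpos (𝕜 := ℂ) |>.1 h8.le
  simpa using h9

/-- The matrix coefficients of the regular representations are the values of `j`. -/
theorem rep_delta (a : T.CStarRed) {u : unitSpace G} {e e' : E} (he : s (T.π e) = u)
    (he' : s (T.π e') = u) : rep T u a (delta e he) e' = T.jMap a (e' * e⁻¹) := by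
  refine denseRange_ofCc.induction_on
    (p := fun a : T.CStarRed => rep T u a (delta e he) e' = T.jMap a (e' * e⁻¹)) a
    (isClosed_eq ?_ (continuous_jMap_apply _)) fun f => ?_
  -- Evaluation at `e'` is the inner product with `δ_{e'}`, hence continuous.
  · simp_rw [← inner_delta e' he']
    fun_prop
  · rw [rep_ofCc, jMap_ofCc]
    exact conv_deltaFun f.equivariant (T.s_eq_of_π (he'.trans he.symm))

/-- `a = 0` as soon as `a δ_e = 0` for all units `e`. -/
theorem eq_zero_of_rep_delta (a : T.CStarRed) (h : ∀ (u : unitSpace G) (e : E)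
    (he : s (T.π e) = u), e ∈ unitSpace E → rep T u a (delta e he) = 0) : a = 0 := by
  -- The value `j(a)(e)` is that of `a δ_{s(e)}` at `e`, because `e s(e)⁻¹ = e`; so units suffice to
  -- show `j(a) = 0`.
  have hj : ∀ e, T.jMap a e = 0 := fun e => by
    have hu : s (T.π (s e)) = (sU (T.π e) : unitSpace G) := by simp
    have h1 := rep_delta a hu (e' := e) rfl
    rw [h _ _ hu (r_s e), inv_of_unit (r_s e), mul_s_self] at h1
    exact h1.symm
  refine rep_ext fun u => ?_
  -- For the adjoint, `(a* ξ)(e) = ⟪a δ_e, ξ⟫`, so it vanishes pointwise and no appeal to density of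
  -- the span of the `δ_e` is needed.
  rw [map_zero, ← star_eq_zero, ContinuousLinearMap.star_eq_adjoint]
  ext ξ : 1
  refine Ell2.ext fun e => ?_
  by_cases he : s (T.π e) = u
  · have h2 : rep T u a (delta e he) = 0 := Ell2.ext fun e' => by
      by_cases he' : s (T.π e') = u
      · rw [rep_delta a he he', hj]; rfl
      · rw [Ell2.eq_zero _ he']; rfl
    rw [← inner_delta e he, ContinuousLinearMap.adjoint_inner_right, h2, inner_zero_left]
    rfl
  · rw [Ell2.eq_zero _ he]; rfl

end CStarRed

end Twist

namespace Twist

variable {G E : Type*} [TopologicalSpace G] [ArrowGroupoid G] [TopologicalSpace E]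
  [ArrowGroupoid E] {T : Twist G E} {S : OpenSubgroupoid G}

/-! ### Extension by zero of square summable functions -/

theorem extFun_add (ξ η : T.preimage S → ℂ) :
    T.extFun (ξ + η) = T.extFun ξ + T.extFun η := by
  ext e
  by_cases he : e ∈ T.preimage S
  · lift e to T.preimage S using he
    simp
  · simp [T.extFun_of_notMem _ he]

theorem extFun_smul (c : ℂ) (ξ : T.preimage S → ℂ) : T.extFun (c • ξ) = c • T.extFun ξ := by
  ext e
  by_cases he : e ∈ T.preimage S
  · lift e to T.preimage S using he
    simp
  · simp [T.extFun_of_notMem _ he]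

/-- Arrows outside `S` contribute zero. Over an arrow of `S` the chosen sections of the two twists
may differ, but only by a phase, which the modulus of an equivariant function does not see. -/
theorem tsum_extFun {ξ : T.preimage S → ℂ} (hξ : (T.restrict S).Equivariant ξ)
    (v : unitSpace S) :
    ∑' g : {g : G // s g = S.unitIncl v}, ‖T.extFun ξ (T.sec g)‖ₑ ^ 2 =
      ∑' g : {g : S // s g = v}, ‖ξ ((T.restrict S).sec g)‖ₑ ^ 2 := by
  let j : {g : S // s g = v} → {g : G // s g = S.unitIncl v} :=
    fun g => ⟨(g : S), congrArg Subtype.val g.2⟩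
  have hj : Function.Injective j := fun g g' h => by
    have h1 : (j g : G) = j g' := congrArg Subtype.val h
    exact Subtype.ext (Subtype.ext h1)
  rw [← hj.tsum_eq]
  · refine tsum_congr fun g => ?_
    rw [← ofReal_norm, ← ofReal_norm, ← T.extFun_coe ξ, (T.extFun_equivariant hξ).norm_eq]
    rw [T.π_sec, ← coe_restrict_π, π_sec]
  · intro g hg
    have hgS : (g : G) ∈ S := by
      by_contra hne
      exact hg (by simp [T.extFun_of_notMem ξ (e := T.sec g) (by
        rwa [mem_preimage_iff, T.π_sec])])
    exact ⟨⟨⟨g, hgS⟩, Subtype.ext g.2⟩, rfl⟩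

theorem extFun_mem_ell2 {v : unitSpace S} (ξ : (T.restrict S).Ell2 v) :
    T.extFun ξ ∈ T.ell2Submodule (S.unitIncl v) := by
  refine ⟨fun e he => ?_, T.extFun_equivariant ξ.equivariant, ?_⟩
  · by_cases heS : e ∈ T.preimage S
    · lift e to T.preimage S using heS
      rw [extFun_coe]
      exact ξ.eq_zero fun h => he (congrArg Subtype.val h)
    · exact T.extFun_of_notMem _ heS
  · have h1 : ∑' g : {g : G // s g = S.unitIncl v}, ‖T.extFun ξ (T.sec g)‖ₑ ^ 2 ≠ ∞ := by
      rw [tsum_extFun ξ.equivariant, ← Ell2.enorm_sq]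
      exact (ENNReal.pow_lt_top enorm_lt_top).ne
    refine memℓp_gen ?_
    simpa using ENNReal.summable_toReal h1

variable (T) in
/-- Extension by zero, as an isometry `ℓ²(S_v;E_{S,v}) → ℓ²(G_v;E_v)`. -/
def extendEll2 (v : unitSpace S) : (T.restrict S).Ell2 v →ₗᵢ[ℂ] T.Ell2 (S.unitIncl v) where
  toFun ξ := ⟨T.extFun ξ, extFun_mem_ell2 ξ⟩
  map_add' ξ η := Subtype.ext (extFun_add (ξ : T.preimage S → ℂ) η)
  map_smul' c ξ := Subtype.ext (extFun_smul c (ξ : T.preimage S → ℂ))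
  norm_map' ξ := by
    let η : T.Ell2 (S.unitIncl v) := ⟨T.extFun ξ, extFun_mem_ell2 ξ⟩
    have h : ‖η‖ₑ ^ 2 = ‖ξ‖ₑ ^ 2 := by
      rw [Ell2.enorm_sq, Ell2.enorm_sq]
      exact tsum_extFun ξ.equivariant v
    have h' := (ENNReal.pow_right_strictMono two_ne_zero).injective h
    rw [enorm_eq_nnnorm, enorm_eq_nnnorm] at h'
    exact congrArg NNReal.toReal (ENNReal.coe_injective h')

/-- The orbit `𝕋 · e` of a point of `E_S` stays inside `E_S`, so the isometry matches the point
vectors. Through this, matrix coefficients of a compression are matrix coefficients of the original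
operator. -/
theorem extendEll2_delta {v : unitSpace S} (e : T.preimage S)
    (he : s ((T.restrict S).π e) = v) :
    T.extendEll2 v (delta e he) = delta (e : E) (congrArg Subtype.val he) := by
  refine Ell2.ext fun e' => ?_
  change T.extFun ((T.restrict S).deltaFun e) e' = T.deltaFun e e'
  by_cases h : T.π (e : E) = T.π e'
  · obtain ⟨z, rfl⟩ := T.exists_act h
    rw [deltaFun_act, ← coe_restrict_act, extFun_coe, deltaFun_act]
  · rw [deltaFun_of_ne (Ne.symm h)]
    by_cases he' : e' ∈ T.preimage S
    · lift e' to T.preimage S using he'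
      rw [extFun_coe]
      exact deltaFun_of_ne fun h' => h (congrArg Subtype.val h').symm
    · exact T.extFun_of_notMem _ he'

/-! ### Compression to square summable functions on the subgroupoid -/

variable (T) in
/-- The compression `W* a W` of an operator `a` on `ℓ²(G_v;E_v)` by the isometry
`W : ℓ²(S_v;E_{S,v}) → ℓ²(G_v;E_v)`. -/
def compress (v : unitSpace S) (a : T.Ell2 (S.unitIncl v) →L[ℂ] T.Ell2 (S.unitIncl v)) :
    (T.restrict S).Ell2 v →L[ℂ] (T.restrict S).Ell2 v :=
  ContinuousLinearMap.adjoint (T.extendEll2 v).toContinuousLinearMap ∘L a ∘L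
    (T.extendEll2 v).toContinuousLinearMap

theorem inner_compress {v : unitSpace S}
    (a : T.Ell2 (S.unitIncl v) →L[ℂ] T.Ell2 (S.unitIncl v)) (ξ η : (T.restrict S).Ell2 v) :
    inner ℂ ξ (T.compress v a η) = inner ℂ (T.extendEll2 v ξ) (a (T.extendEll2 v η)) := by
  rw [compress, ContinuousLinearMap.comp_apply, ContinuousLinearMap.adjoint_inner_right]
  rfl

/-- The adjoint of extension by zero is restriction to `E_S`: pair with `δ_e` and use that the
isometry carries `δ_e` to `δ_e`. At points with source other than `v` both sides are zero. -/
theorem compress_apply {v : unitSpace S}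
    (a : T.Ell2 (S.unitIncl v) →L[ℂ] T.Ell2 (S.unitIncl v)) (ξ : (T.restrict S).Ell2 v)
    (e : T.preimage S) : T.compress v a ξ e = a (T.extendEll2 v ξ) e := by
  by_cases he : s ((T.restrict S).π e) = v
  · rw [← inner_delta e he, inner_compress, extendEll2_delta]
    exact inner_delta (e : E) (congrArg Subtype.val he) _
  · rw [Ell2.eq_zero _ he, Ell2.eq_zero]
    exact fun h => he (Subtype.ext h)

theorem norm_compress_le {v : unitSpace S}
    (a : T.Ell2 (S.unitIncl v) →L[ℂ] T.Ell2 (S.unitIncl v)) : ‖T.compress v a‖ ≤ ‖a‖ := by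
  have hW : ‖(T.extendEll2 v).toContinuousLinearMap‖ ≤ 1 :=
    (T.extendEll2 v).norm_toContinuousLinearMap_le
  have hW' : ‖ContinuousLinearMap.adjoint (T.extendEll2 v).toContinuousLinearMap‖ ≤ 1 := by
    rwa [LinearIsometryEquiv.norm_map]
  calc ‖T.compress v a‖ ≤ 1 * (‖a‖ * 1) := by
        refine (ContinuousLinearMap.opNorm_comp_le _ _).trans ?_
        gcongr
        refine (ContinuousLinearMap.opNorm_comp_le _ _).trans ?_
        gcongr
    _ = ‖a‖ := by ring

@[fun_prop] theorem continuous_compress (v : unitSpace S) :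
    Continuous (T.compress (S := S) v) := by
  unfold compress
  fun_prop

/-- A summand is nonzero only if `σ(g)⁻¹ e` lies in `E_S`; as `e` does too, `g` must lie in `S`. The
function `f` is arbitrary off `E_S`: its values there are never paired with a nonzero value of the
extension. -/
theorem conv_extFun_right {f : E → ℂ} (hf : T.Equivariant f) {ξ : T.preimage S → ℂ}
    (hξ : (T.restrict S).Equivariant ξ) (e : T.preimage S) :
    T.conv f (T.extFun ξ) e = (T.restrict S).conv (fun x => f x) ξ e := by
  let j : {g : S // r g = r ((T.restrict S).π e)} → {g : G // r g = r (T.π e)} :=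
    fun g => ⟨(g : S), congrArg Subtype.val g.2⟩
  have hj : Function.Injective j := fun g g' h => by
    have h1 : (j g : G) = j g' := congrArg Subtype.val h
    exact Subtype.ext (Subtype.ext h1)
  rw [conv, ← hj.tsum_eq, conv]
  · refine tsum_congr fun g => ?_
    set a := (T.restrict S).sec (g : S) with ha
    have hra : r (a : E) = r (e : E) := congrArg Subtype.val ((T.restrict S).r_sec g.2)
    have hπ : T.π (T.sec (j g : G)) = T.π a := by
      exact (T.π_sec _).trans (congrArg Subtype.val ((T.restrict S).π_sec (g : S))).symm
    have hcoe : ((a⁻¹ * e : T.preimage S) : E) = (a : E)⁻¹ * e :=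
      OpenSubgroupoid.coe_mul _ (by simpa using hra)
    rw [hf.term_eq (T.extFun_equivariant hξ) hπ (T.r_sec (j g).2), ← hcoe, extFun_coe]
  · intro g hg
    have hr : r (T.sec g) = r (e : E) := T.r_sec g.2
    have hgS : (T.sec g)⁻¹ * e ∈ T.preimage S := by
      by_contra hne
      exact hg (by simp only [T.extFun_of_notMem ξ hne, mul_zero])
    -- Recover `σ(g)⁻¹` as `(σ(g)⁻¹ e) e⁻¹`, a product of two elements of `E_S`, and invert.
    have h1 : T.sec g ∈ T.preimage S := by
      have h2 := OpenSubgroupoid.mul_mem hgS (OpenSubgroupoid.inv_mem e.2)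
        (by rw [s_mul _ _ (by simpa using hr), r_inv])
      rw [mul_inv_cancel_right' (by simpa using hr)] at h2
      simpa using OpenSubgroupoid.inv_mem h2
    rw [mem_preimage_iff, T.π_sec] at h1
    exact ⟨⟨⟨g, h1⟩, Subtype.ext g.2⟩, rfl⟩

theorem restrictCc_star [LCHGroupoid E] (hS : IsClosed (S : Set G)) (f : T.Cc) :
    T.restrictCc hS (star f) = star (T.restrictCc hS f) := rfl

theorem restrictCc_extendCc [LCHGroupoid E] (hS : IsClosed (S : Set G)) (f : (T.restrict S).Cc) :
    T.restrictCc hS (T.extendCc S f) = f :=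
  Cc.ext fun e => T.extFun_coe f e

variable [EtaleGroupoid G]

/-- The central formula: restricting a function corresponds to compressing its regular
representation. It yields the norm bound and, after extension by continuity, positivity and
faithfulness. -/
theorem compress_theta (hS : IsClosed (S : Set G)) (f : T.Cc) (v : unitSpace S) :
    T.compress v (f.theta (S.unitIncl v)) = (T.restrictCc hS f).theta v := by
  ext ξ : 1
  refine Ell2.ext fun e => ?_
  rw [compress_apply]
  exact conv_extFun_right f.equivariant ξ.equivariant e

/-! ### The conditional expectation -/

variable [LCHGroupoid E]

/-- At each unit of `S` the operator on the left is a compression of the operator at the same unit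
of `G`, so the supremum on the left is bounded by the one on the right. -/
theorem norm_restrictCc_le (hS : IsClosed (S : Set G)) (f : T.Cc) :
    ‖CStarRed.ofCc (T.restrict S) (T.restrictCc hS f)‖ ≤ 1 * ‖CStarRed.ofCc T f‖ := by
  rw [one_mul]
  refine CStarRed.norm_le (norm_nonneg _) fun v => ?_
  rw [CStarRed.rep_ofCc, ← compress_theta hS]
  exact (norm_compress_le _).trans (CStarRed.norm_rep_le _ (CStarRed.ofCc T f))

variable (T) in
/-- The continuous linear extension `C*_r(G;E) → C*_r(S;E_S)` of the restriction
`C_c(G;E) → C_c(S;E_S)`. -/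
def restrictRed (hS : IsClosed (S : Set G)) : T.CStarRed →L[ℂ] (T.restrict S).CStarRed :=
  (CStarRed.ofCc (T.restrict S) ∘ₗ T.restrictCc hS).extendOfNorm (CStarRed.ofCc T)

variable {hS : IsClosed (S : Set G)}

theorem restrictRed_ofCc (f : T.Cc) :
    T.restrictRed hS (CStarRed.ofCc T f) =
      CStarRed.ofCc (T.restrict S) (T.restrictCc hS f) :=
  LinearMap.extendOfNorm_eq (f := CStarRed.ofCc (T.restrict S) ∘ₗ T.restrictCc hS)
    CStarRed.denseRange_ofCc ⟨1, norm_restrictCc_le hS⟩ f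

theorem norm_restrictRed_le (a : T.CStarRed) : ‖T.restrictRed hS a‖ ≤ ‖a‖ := by
  have h := LinearMap.norm_extendOfNorm_apply_le
    (f := CStarRed.ofCc (T.restrict S) ∘ₗ T.restrictCc hS)
    CStarRed.denseRange_ofCc 1 (norm_restrictCc_le hS) a
  rwa [one_mul] at h

/-- Both sides are continuous in `a`, so `compress_theta` extends from the dense subspace. This
makes `Φ` computable on elements, such as `a* a`, that need not come from functions. -/
theorem rep_restrictRed (a : T.CStarRed) (v : unitSpace S) :
    CStarRed.rep (T.restrict S) v (T.restrictRed hS a) =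
      T.compress v (CStarRed.rep T (S.unitIncl v) a) := by
  refine CStarRed.denseRange_ofCc.induction_on
    (p := fun a : T.CStarRed => CStarRed.rep (T.restrict S) v (T.restrictRed hS a) =
      T.compress v (CStarRed.rep T (S.unitIncl v) a)) a
    (isClosed_eq (by fun_prop) (by fun_prop)) fun f => ?_
  rw [restrictRed_ofCc, CStarRed.rep_ofCc, CStarRed.rep_ofCc, compress_theta]

theorem restrictRed_star (a : T.CStarRed) :
    T.restrictRed hS (star a) = star (T.restrictRed hS a) := by
  refine CStarRed.denseRange_ofCc.induction_on
    (p := fun a : T.CStarRed => T.restrictRed hS (star a) = star (T.restrictRed hS a)) a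
    (isClosed_eq (by fun_prop) (by fun_prop)) fun f => ?_
  rw [← CStarRed.ofCc_star, restrictRed_ofCc, restrictRed_ofCc, restrictCc_star,
    CStarRed.ofCc_star]

/-! ### The bimodule property -/

theorem restrictRed_iMap (b : (T.restrict S).CStarRed) :
    T.restrictRed hS (T.iMap S b) = b := by
  refine CStarRed.denseRange_ofCc.induction_on
    (p := fun b : (T.restrict S).CStarRed => T.restrictRed hS (T.iMap S b) = b) b
    (isClosed_eq ((T.restrictRed hS).continuous.comp (T.iLin S).continuous) continuous_id)
    fun f => ?_
  rw [iMap_ofCc, restrictRed_ofCc, restrictCc_extendCc]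

/-- The extension of `f` vanishes off `E_S`, so only `g` in `S` contributes to the product at a
point `e` of `E_S`; then `σ(g)⁻¹ e` is again in `E_S`, and the second factor is evaluated only
there. -/
theorem restrictCc_extendCc_mul (f : (T.restrict S).Cc) (g : T.Cc) :
    T.restrictCc hS (T.extendCc S f * g) = f * T.restrictCc hS g := by
  ext e
  -- Write `e` as `e s(e)`: translating by the unit `s(e)` changes no value, so `conv_extFun`
  -- becomes a statement about the restriction of `g`.
  have h1 := conv_extFun f.equivariant g.equivariant (e := s (e : E)) e (r_s _).symm
  rw [mul_s_self] at h1
  rw [restrictCc_apply, Cc.coe_mul, coe_extendCc, h1, Cc.coe_mul, conv, conv]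
  refine tsum_congr fun k => ?_
  congr 1
  set a := (T.restrict S).sec (k : S) with ha
  have hra : r (a : E) = r (e : E) := congrArg Subtype.val ((T.restrict S).r_sec k.2)
  have hcoe : ((a⁻¹ * e : T.preimage S) : E) = (a : E)⁻¹ * e :=
    OpenSubgroupoid.coe_mul _ (by simpa using hra)
  have hs : s ((a⁻¹ * e : T.preimage S) : E) = s (e : E) := by
    rw [hcoe, s_mul _ _ (by simpa using hra)]
  rw [translateFun, if_pos (by rw [hs, r_s]), ← hs, mul_s_self, restrictCc_apply]

theorem restrictRed_iMap_mul (b : (T.restrict S).CStarRed) (a : T.CStarRed) :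
    T.restrictRed hS (T.iMap S b * a) = b * T.restrictRed hS a := by
  have hi : Continuous (T.iMap S) := (T.iLin S).continuous
  refine CStarRed.denseRange_ofCc.induction_on (p := fun b =>
      T.restrictRed hS (T.iMap S b * a) = b * T.restrictRed hS a) b
    (isClosed_eq (by fun_prop) (by fun_prop)) fun f => ?_
  refine CStarRed.denseRange_ofCc.induction_on (p := fun a : T.CStarRed =>
      T.restrictRed hS (T.iMap S (CStarRed.ofCc _ f) * a) =
        CStarRed.ofCc _ f * T.restrictRed hS a) a
    (isClosed_eq (by fun_prop) (by fun_prop)) fun g => ?_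
  rw [iMap_ofCc, ← CStarRed.ofCc_mul, restrictRed_ofCc, restrictRed_ofCc,
    restrictCc_extendCc_mul, CStarRed.ofCc_mul]

/-- Both `Φ` and `i` respect the involution, so this is the left-hand identity for `b*` and `a*`
after taking adjoints. -/
theorem restrictRed_mul_iMap (a : T.CStarRed) (b : (T.restrict S).CStarRed) :
    T.restrictRed hS (a * T.iMap S b) = T.restrictRed hS a * b := by
  have h := congrArg star (restrictRed_iMap_mul (hS := hS) (star b) (star a))
  rwa [← restrictRed_star, map_star (T.iMap S), star_mul, star_star, star_star, star_mul,
    star_star, restrictRed_star, star_star] at h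

/-! ### Complete positivity and the conditional expectation -/

/-- Write the positive matrix as `N* N`. Since `Φ` is a compression in each regular representation,
its quadratic form is that of `N* N` on vectors extended by zero, that is, a sum of squared norms;
`cstarMatrix_nonneg` concludes. -/
theorem restrictRed_cstarMatrix_nonneg {k : ℕ} {M : CStarMatrix (Fin k) (Fin k) T.CStarRed}
    (hM : 0 ≤ M) : 0 ≤ M.map (T.restrictRed hS) := by
  refine CStarRed.cstarMatrix_nonneg ?_ fun v η => ?_
  · ext i j
    have h := congrFun (congrFun (IsSelfAdjoint.of_nonneg hM).star_eq i) j
    rw [CStarMatrix.star_apply] at h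
    rw [CStarMatrix.star_apply, CStarMatrix.map_apply, CStarMatrix.map_apply, ← restrictRed_star,
      h]
  · obtain ⟨N, rfl⟩ := exists_eq_star_mul_self hM
    have h1 : ∀ i j, inner ℂ (η i) (CStarRed.rep (T.restrict S) v
        ((star N * N).map (T.restrictRed hS) i j) (η j)) =
        ∑ l, inner ℂ (CStarRed.rep T _ (N l i) (T.extendEll2 v (η i)))
          (CStarRed.rep T _ (N l j) (T.extendEll2 v (η j))) := by
      intro i j
      rw [CStarMatrix.map_apply, rep_restrictRed, inner_compress, CStarMatrix.mul_apply, map_sum,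
        sum_apply, inner_sum]
      refine Finset.sum_congr rfl fun l _ => ?_
      rw [CStarMatrix.star_apply, CStarRed.inner_rep_star_mul]
    have h2 : ∑ i, ∑ j, inner ℂ (η i) (CStarRed.rep (T.restrict S) v
        ((star N * N).map (T.restrictRed hS) i j) (η j)) =
        ∑ l, inner ℂ (∑ i, CStarRed.rep T _ (N l i) (T.extendEll2 v (η i)))
          (∑ j, CStarRed.rep T _ (N l j) (T.extendEll2 v (η j))) := by
      simp_rw [h1, sum_inner, inner_sum]
      -- The index `l` of the factorization is moved outermost, past `j` and then past `i`.
      exact (Finset.sum_congr rfl fun i _ => Finset.sum_comm).trans Finset.sum_comm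
    rw [h2, Complex.re_sum]
    exact Finset.sum_nonneg fun l _ => inner_self_nonneg (𝕜 := ℂ)

theorem isConditionalExpectation_restrictRed (hS : IsClosed (S : Set G)) :
    IsConditionalExpectation (NonUnitalStarAlgHom.range (T.iMap S))
      (fun a => T.iMap S (T.restrictRed hS a)) where
  completelyPositive :=
    ⟨{ toLinearMap := (T.iLin S ∘L T.restrictRed hS).toLinearMap
       -- The composite is completely positive because `i`, being a *-homomorphism, preserves
       -- positivity of matrices as well.
       map_cstarMatrix_nonneg' := fun k M hM =>
        CompletelyPositiveMapClass.map_cstarMatrix_nonneg' (T.iMap S) k _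
          (restrictRed_cstarMatrix_nonneg (hS := hS) hM) }, fun a => rfl⟩
  contractive a := (NonUnitalStarAlgHom.norm_apply_le (T.iMap S) _).trans (norm_restrictRed_le a)
  map_mem a := ⟨_, rfl⟩
  map_of_mem := by
    rintro _ ⟨b, rfl⟩
    exact congrArg (T.iMap S) (restrictRed_iMap b)
  map_mul_left := by
    rintro _ ⟨b, rfl⟩ a
    exact (congrArg (T.iMap S) (restrictRed_iMap_mul b a)).trans (map_mul _ _ _)
  map_mul_right := by
    rintro _ ⟨b, rfl⟩ a
    exact (congrArg (T.iMap S) (restrictRed_mul_iMap a b)).trans (map_mul _ _ _)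

/-! ### Compatibility with `j`, and faithfulness -/

theorem jMap_restrictRed (a : T.CStarRed) (e : T.preimage S) :
    (T.restrict S).jMap (T.restrictRed hS a) e = T.jMap a (e : E) := by
  refine CStarRed.denseRange_ofCc.induction_on
    (p := fun a : T.CStarRed =>
      (T.restrict S).jMap (T.restrictRed hS a) e = T.jMap a (e : E)) a
    (isClosed_eq ((continuous_jMap_apply e).comp (T.restrictRed hS).continuous)
      (continuous_jMap_apply _)) fun f => ?_
  rw [restrictRed_ofCc, jMap_ofCc, jMap_ofCc, ccToC0_apply, ccToC0_apply, restrictCc_apply]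

/-- For a unit `e`, equality of the unit spaces puts `e` in `E_S`, so `δ_e` lies in the range of the
isometry and the diagonal coefficient of `Φ(a* a)` at `δ_e` is `‖a δ_e‖²`. Its vanishing at all
units forces `a = 0` by `eq_zero_of_rep_delta`. -/
theorem eq_zero_of_restrictRed_star_mul_self
    (h0 : Subtype.val '' unitSpace S = unitSpace G) {a : T.CStarRed}
    (ha : T.restrictRed hS (star a * a) = 0) : a = 0 := by
  refine CStarRed.eq_zero_of_rep_delta a fun u e he heu => ?_
  obtain ⟨v, hv, hvu⟩ : (u : G) ∈ Subtype.val '' unitSpace S := by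
    rw [h0]; exact u.2
  obtain rfl : S.unitIncl ⟨v, hv⟩ = u := Subtype.ext hvu
  have heS : e ∈ T.preimage S := by
    -- As `e` is a unit, `π(e) = s(π(e))`, which is the unit `v` of `S`.
    rw [mem_preimage_iff, ← r_of_unit heu, ← s_of_unit heu, r_s, T.π_s, he]
    exact v.2
  lift e to T.preimage S using heS
  have he' : s ((T.restrict S).π e) = (⟨v, hv⟩ : unitSpace S) := Subtype.ext he
  have h1 : inner ℂ (delta e he') (CStarRed.rep (T.restrict S) ⟨v, hv⟩
      (T.restrictRed hS (star a * a)) (delta e he')) = 0 := by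
    rw [ha, map_zero, zero_apply, inner_zero_right]
  rw [rep_restrictRed, inner_compress, extendEll2_delta, CStarRed.inner_rep_star_mul] at h1
  exact inner_self_eq_zero.1 h1

end Twist

end TwistedGroupoid

end

theorem proposition3p6 {G E : Type*}
    [TopologicalSpace G] [TwistedGroupoid.ArrowGroupoid G] [TwistedGroupoid.EtaleGroupoid G]
    [TopologicalSpace E] [TwistedGroupoid.ArrowGroupoid E] [TwistedGroupoid.LCHGroupoid E]
    (T : TwistedGroupoid.Twist G E) (S : TwistedGroupoid.OpenSubgroupoid G)
    (hS : IsClosed (S : Set G)) :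
    ∃ Φ : T.CStarRed →L[ℂ] (T.restrict S).CStarRed,
      (∀ f : T.Cc, Φ (TwistedGroupoid.Twist.CStarRed.ofCc T f) =
        TwistedGroupoid.Twist.CStarRed.ofCc (T.restrict S) (T.restrictCc hS f)) ∧
      (∀ a : T.CStarRed, ‖Φ a‖ ≤ ‖a‖) ∧
      TwistedGroupoid.IsConditionalExpectation (NonUnitalStarAlgHom.range (T.iMap S))
        (fun a => T.iMap S (Φ a)) ∧
      (∀ (a : T.CStarRed) (e : T.preimage S), (T.restrict S).jMap (Φ a) e = T.jMap a (e : E)) ∧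
      (Subtype.val '' TwistedGroupoid.unitSpace S = TwistedGroupoid.unitSpace G →
        (∀ a : T.CStarRed, Φ (star a * a) = 0 → a = 0) ∧
        TwistedGroupoid.IsFaithful (fun a : T.CStarRed => T.iMap S (Φ a))) := by
  refine ⟨T.restrictRed hS, TwistedGroupoid.Twist.restrictRed_ofCc,
    TwistedGroupoid.Twist.norm_restrictRed_le,
    TwistedGroupoid.Twist.isConditionalExpectation_restrictRed hS,
    TwistedGroupoid.Twist.jMap_restrictRed, fun h0 =>
    ⟨fun a => TwistedGroupoid.Twist.eq_zero_of_restrictRed_star_mul_self h0, fun a ha =>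
    TwistedGroupoid.Twist.eq_zero_of_restrictRed_star_mul_self (hS := hS) h0 ?_⟩⟩
  -- Since `Φ ∘ i = id`, the map `i` is injective, so `i(Φ(a* a)) = 0` already gives `Φ(a* a) = 0`.
  have h := TwistedGroupoid.Twist.restrictRed_iMap (hS := hS) (T.restrictRed hS (star a * a))
  exact h.symm.trans ((congrArg (T.restrictRed hS) ha).trans (map_zero _))
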